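/- There is an algorithm for the Eccentricity Shortest Path problem parameterized by the size of a given split vertex deletion set (ESP/svd) that runs in time $O\bigl(2^{O(k\log k)}\cdot n^{O(1)}\bigr)$. Here an instance of ESP/svd consists of a finite, simple, undirected, connected graph $G$ on $n$ vertices, a set $S\subseteq V(G)$ of size $k$ such that $G-S$ is a split graph (its vertices can be partitioned into a clique and an independent set), and an integer $\ell$; the question is whether $G$ has a shortest path $P$ (a path whose length equals the distance in $G$ between its endpoints) such that every vertex $v\in V(G)$ satisfies $d_G(v,P)=\min_{w\in V(P)}d_G(v,w)\le\ell$. That is, there are one random access machine program (with unit-cost addition, truncated subtraction and indirect addressing, but no multiplication) and absolute constants $a,b,c$ such that on every instance the program halts with the correct yes/no answer after at most $a\cdot 2^{b\,k\log_2 k}\cdot n^{c}$ steps, where $k\log_2 k$ is read as $0$ for $k=0$. In particular, ESP is fixed-parameter tractable parameterized by $k$. -/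

import Mathlib

/-! ### The graph problem -/

/-- A split graph: the vertices can be partitioned into a clique and an independent set. -/
def IsSplitGraph {V : Type*} (H : SimpleGraph V) : Prop :=
  ∃ C I : Set V, C ∪ I = Set.univ ∧ Disjoint C I ∧ H.IsClique C ∧ H.IsIndepSet I

/-- `S` is a split vertex deletion set of `G`: the graph `G - S` is a split graph. -/
def IsSplitVertexDeletionSet {V : Type*} (G : SimpleGraph V) (S : Set V) : Prop :=
  IsSplitGraph (G.induce Sᶜ)

/-- A shortest path of `G`: a path whose length is the distance of its endpoints. -/
def IsShortestPath {V : Type*} {G : SimpleGraph V} {x y : V} (P : G.Walk x y) : Prop :=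
  P.IsPath ∧ P.length = G.dist x y

/-- The distance from a vertex `v` to a path `P`: the least distance from `v` to a vertex of `P`. -/
noncomputable def distToPath {V : Type*} {G : SimpleGraph V} {x y : V}
    (v : V) (P : G.Walk x y) : ℕ :=
  sInf {d | ∃ w ∈ P.support, d = G.dist v w}

/-- The question of the eccentricity shortest path problem: is there a shortest path `P` of `G`
such that every vertex of `G` is at distance at most `l` from `P`? -/
def HasEccentricityShortestPath {V : Type*} (G : SimpleGraph V) (l : ℤ) : Prop :=
  ∃ (x y : V) (P : G.Walk x y), IsShortestPath P ∧ ∀ v : V, (distToPath v P : ℤ) ≤ l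

/-! ### The machine model

A random access machine with structured control flow: natural number registers, finitely many
(per program) unbounded arrays with indirect addressing, constants, addition and truncated
subtraction, every elementary operation costing one step. Multiplication is not an elementary
operation, so numbers have polynomially many bits in the number of steps plus the input length, and
the machine is polynomially equivalent to Turing machines. -/

namespace Ram

/-- A memory state: register `x` holds `reg x`, and cell `i` of array `a` holds `arr a i`. -/
structure State where
  reg : ℕ → ℕ
  arr : ℕ → ℕ → ℕ

/-- Arithmetic expressions. In `read a e` the array `a` is fixed by the program and the index is
the value of `e`. -/
inductive Expr where
  | const (c : ℕ)
  | reg (x : ℕ)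
  | read (a : ℕ) (e : Expr)
  | add (e₁ e₂ : Expr)
  | sub (e₁ e₂ : Expr)

/-- The value of an expression in a state. -/
def Expr.eval (s : State) : Expr → ℕ
  | .const c => c
  | .reg x => s.reg x
  | .read a e => s.arr a (e.eval s)
  | .add e₁ e₂ => e₁.eval s + e₂.eval s
  | .sub e₁ e₂ => e₁.eval s - e₂.eval s

/-- The number of steps that the evaluation of an expression takes. -/
def Expr.cost : Expr → ℕ
  | .const _ => 1
  | .reg _ => 1
  | .read _ e => e.cost + 1
  | .add e₁ e₂ => e₁.cost + e₂.cost + 1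
  | .sub e₁ e₂ => e₁.cost + e₂.cost + 1

/-- Programs. Conditionals and loops test whether the value of an expression is nonzero. -/
inductive Prog where
  | skip
  | assign (x : ℕ) (e : Expr)
  | write (a : ℕ) (i e : Expr)
  | seq (p q : Prog)
  | ite (e : Expr) (p q : Prog)
  | loop (e : Expr) (p : Prog)

/-- Overwrite register `x` by `v`. -/
def State.setReg (s : State) (x v : ℕ) : State :=
  { s with reg := Function.update s.reg x v }

/-- Overwrite cell `i` of array `a` by `v`. -/
def State.setArr (s : State) (a i v : ℕ) : State :=
  { s with arr := Function.update s.arr a (Function.update (s.arr a) i v) }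

/-- `Exec p s s' t`: the program `p`, started in the state `s`, halts after exactly `t` steps in the
state `s'`. -/
inductive Exec : Prog → State → State → ℕ → Prop
  | skip (s : State) : Exec .skip s s 1
  | assign (s : State) (x : ℕ) (e : Expr) :
      Exec (.assign x e) s (s.setReg x (e.eval s)) (e.cost + 1)
  | write (s : State) (a : ℕ) (i e : Expr) :
      Exec (.write a i e) s (s.setArr a (i.eval s) (e.eval s)) (i.cost + e.cost + 1)
  | seq {p q : Prog} {s s' s'' : State} {t t' : ℕ} :
      Exec p s s' t → Exec q s' s'' t' → Exec (.seq p q) s s'' (t + t')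
  | ite_true {e : Expr} {p q : Prog} {s s' : State} {t : ℕ} :
      e.eval s ≠ 0 → Exec p s s' t → Exec (.ite e p q) s s' (e.cost + 1 + t)
  | ite_false {e : Expr} {p q : Prog} {s s' : State} {t : ℕ} :
      e.eval s = 0 → Exec q s s' t → Exec (.ite e p q) s s' (e.cost + 1 + t)
  | loop_done {e : Expr} {p : Prog} {s : State} :
      e.eval s = 0 → Exec (.loop e p) s s (e.cost + 1)
  | loop_step {e : Expr} {p : Prog} {s s' s'' : State} {t t' : ℕ} :
      e.eval s ≠ 0 → Exec p s s' t → Exec (.loop e p) s' s'' t' →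
      Exec (.loop e p) s s'' (e.cost + 1 + t + t')

/-- The machine is deterministic: final state and step count are functions of the start. -/
theorem Exec.deterministic {p : Prog} {s s₁ s₂ : State} {t₁ t₂ : ℕ}
    (h₁ : Exec p s s₁ t₁) (h₂ : Exec p s s₂ t₂) : s₁ = s₂ ∧ t₁ = t₂ := by
  induction h₁ generalizing s₂ t₂ with
  | skip => cases h₂; simp
  | assign => cases h₂; simp
  | write => cases h₂; simp
  | seq _ _ ih ih' =>
    cases h₂ with
    | seq a b =>
      obtain ⟨rfl, rfl⟩ := ih a
      obtain ⟨rfl, rfl⟩ := ih' b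
      simp
  | ite_true he _ ih =>
    cases h₂ with
    | ite_true _ a => obtain ⟨rfl, rfl⟩ := ih a; simp
    | ite_false h _ => exact absurd h he
  | ite_false he _ ih =>
    cases h₂ with
    | ite_true h _ => exact absurd he h
    | ite_false _ a => obtain ⟨rfl, rfl⟩ := ih a; simp
  | loop_done he =>
    cases h₂ with
    | loop_done => simp
    | loop_step h _ _ => exact absurd he h
  | loop_step he _ _ ih ih' =>
    cases h₂ with
    | loop_done h => exact absurd h he
    | loop_step _ a b =>
      obtain ⟨rfl, rfl⟩ := ih a
      obtain ⟨rfl, rfl⟩ := ih' b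
      simp

end Ram

open Classical in
/-- The input state for a graph `G` on the vertices `0, …, n - 1`, a vertex set `S` and an integer
`l`: register `0` holds `n`, registers `1` and `2` hold the positive and the negative part of `l`,
array `0` holds the adjacency matrix of `G` row by row, array `1` holds the indicator vector of `S`,
and everything else is `0`. -/
noncomputable def espInput {n : ℕ} (G : SimpleGraph (Fin n)) (S : Finset (Fin n)) (l : ℤ) :
    Ram.State where
  reg
    | 0 => n
    | 1 => l.toNat
    | 2 => (-l).toNat
    | _ => 0
  arr
    | 0 => fun c => if ∃ i j : Fin n, c = (i : ℕ) * n + (j : ℕ) ∧ G.Adj i j then 1 else 0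
    | 1 => fun c => if ∃ i ∈ S, c = (i : ℕ) then 1 else 0
    | _ => fun _ => 0

/-! In a split graph every non-isolated vertex lies in the clique or next to it. So the vertices
outside `S` that have a neighbour outside `S` are pairwise at distance at most 3 in `G`, and a
shortest path contains at most four of them (`Walk.exists_four_of_dist_le_three`). Every other path
vertex outside `S` has all its neighbours in `S`.

Guess the first vertex of the path and these at most four vertices: `n ^ 5` guesses. Together with
`S` they form `k + 5` marked vertices. Apart from degenerate paths, domination depends only on `2 *
(k + 5)` bits: which marked vertices lie on the path, and which are adjacent to it. Indeed, if `v`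
is within `l` of an unmarked path vertex `p ≠ v`, a shortest path from `p` to `v` enters `S` at its
first step, so a marked vertex adjacent to the path is within `l - 1` of `v`
(`witnessed_of_exists_dist_le`, `hasEccentricityShortestPath_iff_witnessed`).

Each bit is set by a single vertex of the path, so a dynamic program over length, guess, last vertex
and bit set finds all walks that set prescribed bits (`hasMarkedWalk_succ_iff`); a walk no longer
than the distance of its ends is a shortest path. The table has `M = n ^ 7 * 2 ^ (2 * (k + 5))`
cells and the work is polynomial in `M`, hence even `2 ^ O(k) * n ^ O(1)` (`bound_le`).

On the machine, the algorithm is a fixed list of table fillings by terms with bounded sums, which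
also express quantifiers, products and quotients. Such a list compiles to a program whose time is
polynomial in the largest loop bound (`Term.exec_comp`, `Cmd.exec_compList`); what remains is to
evaluate the terms. -/

namespace Ram

/-! ### Expressions with bounded sums, and their compilation -/

/-- Prepend a value to an environment. -/
def scons (j : ℕ) (v : ℕ → ℕ) : ℕ → ℕ
  | 0 => j
  | i + 1 => v i

/-- Arithmetic terms over twelve global registers, the arrays and de Bruijn variables, with bounded
sums. The bound of a sum is one of the global registers `3, …, 11`. -/
inductive Term where
  | const (c : ℕ)
  | glob (g : Fin 12)
  | var (i : ℕ)
  | read (a : ℕ) (e : Term)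
  | add (e₁ e₂ : Term)
  | sub (e₁ e₂ : Term)
  | ite (c e₁ e₂ : Term)
  | sum (g : Fin 9) (e : Term)

namespace Term

/-- The value of a term. -/
def eval (s : State) : (ℕ → ℕ) → Term → ℕ
  | _, const c => c
  | _, glob g => s.reg g
  | v, var i => v i
  | v, read a e => s.arr a (e.eval s v)
  | v, add e₁ e₂ => e₁.eval s v + e₂.eval s v
  | v, sub e₁ e₂ => e₁.eval s v - e₂.eval s v
  | v, ite c e₁ e₂ => if c.eval s v ≠ 0 then e₁.eval s v else e₂.eval s v
  | v, sum g e => ∑ j ∈ Finset.range (s.reg (g + 3)), e.eval s (scons j v)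

/-- An upper bound for the number of steps of the compiled term. -/
def cost (r : ℕ → ℕ) : Term → ℕ
  | const _ => 2
  | glob _ => 2
  | var _ => 2
  | read _ e => e.cost r + 3
  | add e₁ e₂ => e₁.cost r + e₂.cost r + 4
  | sub e₁ e₂ => e₁.cost r + e₂.cost r + 4
  | ite c e₁ e₂ => c.cost r + e₁.cost r + e₂.cost r + 2
  | sum g e => r (g + 3) * (e.cost r + 12) + 8

/-- The compiled term: the value goes to register `t`, only registers from `t` on are changed, and
variable `i` is read from register `ρ i`. -/
def comp : (ℕ → ℕ) → ℕ → Term → Prog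
  | _, t, const c => .assign t (.const c)
  | _, t, glob g => .assign t (.reg g)
  | ρ, t, var i => .assign t (.reg (ρ i))
  | ρ, t, read a e => .seq (e.comp ρ t) (.assign t (.read a (.reg t)))
  | ρ, t, add e₁ e₂ => .seq (e₁.comp ρ t) (.seq (e₂.comp ρ (t + 1))
      (.assign t (.add (.reg t) (.reg (t + 1)))))
  | ρ, t, sub e₁ e₂ => .seq (e₁.comp ρ t) (.seq (e₂.comp ρ (t + 1))
      (.assign t (.sub (.reg t) (.reg (t + 1)))))
  | ρ, t, ite c e₁ e₂ => .seq (c.comp ρ t) (.ite (.reg t) (e₁.comp ρ t) (e₂.comp ρ t))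
  | ρ, t, sum g e => .seq (.assign t (.const 0)) (.seq (.assign (t + 1) (.const 0))
      (.loop (.sub (.reg (g + 3)) (.reg (t + 1)))
        (.seq (e.comp (scons (t + 1) ρ) (t + 2))
          (.seq (.assign t (.add (.reg t) (.reg (t + 2))))
            (.assign (t + 1) (.add (.reg (t + 1)) (.const 1)))))))

/-- Terms mention only registers below `12`, and the code compiled from them writes only registers
from `12` on. So scratch work for one subterm does not disturb the others. -/
theorem eval_congr {s s' : State} (h : ∀ r < 12, s.reg r = s'.reg r) (h' : s.arr = s'.arr)
    (e : Term) (v : ℕ → ℕ) : e.eval s v = e.eval s' v := by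
  induction e generalizing v with
  | const | var => rfl
  | glob g => exact h g g.isLt
  | read a e ih => simp only [eval, ih, h']
  | add _ _ ih₁ ih₂ | sub _ _ ih₁ ih₂ => simp only [eval, ih₁, ih₂]
  | ite _ _ _ ih₁ ih₂ ih₃ => simp only [eval, ih₁, ih₂, ih₃]
  | sum g e ih => simp only [eval, ih, h (g + 3) (by omega)]

theorem cost_congr {r r' : ℕ → ℕ} (h : ∀ x < 12, r x = r' x) (e : Term) :
    e.cost r = e.cost r' := by
  induction e with
  | const | var | glob => rfl
  | read a e ih => simp only [cost, ih]
  | add _ _ ih₁ ih₂ | sub _ _ ih₁ ih₂ => simp only [cost, ih₁, ih₂]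
  | ite _ _ _ ih₁ ih₂ ih₃ => simp only [cost, ih₁, ih₂, ih₃]
  | sum g e ih => simp only [cost, ih, h (g + 3) (by omega)]

/-- A sum multiplies the cost by one loop bound and all other constructors only add, so the degree
depends on the term alone. Degrees of subterms are added where a maximum would do, which is
harmless. -/
theorem cost_le (e : Term) : ∃ C d : ℕ, ∀ (r : ℕ → ℕ) (M : ℕ), 1 ≤ M →
    (∀ x, 3 ≤ x → x < 12 → r x ≤ M) → e.cost r ≤ C * M ^ d := by
  have add2 : ∀ {C₁ d₁ C₂ d₂ c M a b : ℕ}, 1 ≤ M → a ≤ C₁ * M ^ d₁ → b ≤ C₂ * M ^ d₂ →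
      a + b + c ≤ (C₁ + C₂ + c) * M ^ (d₁ + d₂) := by
    intro C₁ d₁ C₂ d₂ c M a b hM ha hb
    have h₁ : C₁ * M ^ d₁ ≤ C₁ * M ^ (d₁ + d₂) :=
      Nat.mul_le_mul_left _ (Nat.pow_le_pow_right hM (by omega))
    have h₂ : C₂ * M ^ d₂ ≤ C₂ * M ^ (d₁ + d₂) :=
      Nat.mul_le_mul_left _ (Nat.pow_le_pow_right hM (by omega))
    have h₃ : c * 1 ≤ c * M ^ (d₁ + d₂) := Nat.mul_le_mul_left _ (Nat.one_le_pow _ _ hM)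
    rw [add_mul, add_mul]
    omega
  induction e with
  | const | var | glob => exact ⟨2, 0, fun r M _ _ => by simp [cost]⟩
  | read a e ih =>
    obtain ⟨C, d, ih⟩ := ih
    exact ⟨C + 0 + 3, d + 0, fun r M hM h =>
      add2 (b := 0) (C₂ := 0) (d₂ := 0) (c := 3) hM (ih r M hM h) (by simp)⟩
  | add _ _ ih₁ ih₂ | sub _ _ ih₁ ih₂ =>
    obtain ⟨C₁, d₁, ih₁⟩ := ih₁
    obtain ⟨C₂, d₂, ih₂⟩ := ih₂
    exact ⟨_, _, fun r M hM h => add2 hM (ih₁ r M hM h) (ih₂ r M hM h)⟩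
  | ite _ _ _ ih₁ ih₂ ih₃ =>
    obtain ⟨C₁, d₁, ih₁⟩ := ih₁
    obtain ⟨C₂, d₂, ih₂⟩ := ih₂
    obtain ⟨C₃, d₃, ih₃⟩ := ih₃
    exact ⟨_, _, fun r M hM h =>
      add2 hM (add2 (c := 0) hM (ih₁ r M hM h) (ih₂ r M hM h)) (ih₃ r M hM h)⟩
  | sum g e ih =>
    obtain ⟨C, d, ih⟩ := ih
    refine ⟨C + 12 + 8, d + 1, fun r M hM h => ?_⟩
    have h₁ := ih r M hM h
    have h₂ := h (g + 3) (by omega) (by omega)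
    have h₃ : 1 ≤ M ^ d := Nat.one_le_pow _ _ hM
    have h₄ : r (g + 3) * (e.cost r + 12) ≤ M * (C * M ^ d + 12) :=
      Nat.mul_le_mul h₂ (by omega)
    simp only [cost]
    rw [pow_succ]
    nlinarith [Nat.mul_le_mul hM h₃]

/-- The registers form a stack with top `t`: loop variables and pending values sit below `t` and
survive the evaluation of a subterm. A sum keeps its accumulator in `t` and its counter, the new
variable `0`, in `t + 1`, and evaluates its body from `t + 2` on. -/
theorem exec_comp (e : Term) : ∀ (ρ v : ℕ → ℕ) (t : ℕ) (s : State), 12 ≤ t → (∀ i, ρ i < t) →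
    (∀ i, s.reg (ρ i) = v i) →
    ∃ s' τ, Exec (e.comp ρ t) s s' τ ∧ τ ≤ e.cost s.reg ∧ s'.reg t = e.eval s v ∧
      (∀ r < t, s'.reg r = s.reg r) ∧ s'.arr = s.arr := by
  have binary : ∀ (e₁ e₂ : Term),
      (∀ (ρ v : ℕ → ℕ) (t : ℕ) (s : State), 12 ≤ t → (∀ i, ρ i < t) →
        (∀ i, s.reg (ρ i) = v i) →
        ∃ s' τ, Exec (e₁.comp ρ t) s s' τ ∧ τ ≤ e₁.cost s.reg ∧ s'.reg t = e₁.eval s v ∧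
          (∀ r < t, s'.reg r = s.reg r) ∧ s'.arr = s.arr) →
      (∀ (ρ v : ℕ → ℕ) (t : ℕ) (s : State), 12 ≤ t → (∀ i, ρ i < t) →
        (∀ i, s.reg (ρ i) = v i) →
        ∃ s' τ, Exec (e₂.comp ρ t) s s' τ ∧ τ ≤ e₂.cost s.reg ∧ s'.reg t = e₂.eval s v ∧
          (∀ r < t, s'.reg r = s.reg r) ∧ s'.arr = s.arr) →
      ∀ (ρ v : ℕ → ℕ) (t : ℕ) (s : State), 12 ≤ t → (∀ i, ρ i < t) → (∀ i, s.reg (ρ i) = v i) →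
        ∃ s' τ, (∀ (q : Prog) s'' τ', Exec q s' s'' τ' →
            Exec (.seq (e₁.comp ρ t) (.seq (e₂.comp ρ (t + 1)) q)) s s'' (τ + τ')) ∧
          τ ≤ e₁.cost s.reg + e₂.cost s.reg ∧ s'.reg t = e₁.eval s v ∧
          s'.reg (t + 1) = e₂.eval s v ∧ (∀ r < t, s'.reg r = s.reg r) ∧ s'.arr = s.arr := by
    intro e₁ e₂ ih₁ ih₂ ρ v t s ht hρ hv
    obtain ⟨s₁, τ₁, x₁, c₁, r₁, k₁, a₁⟩ := ih₁ ρ v t s ht hρ hv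
    obtain ⟨s₂, τ₂, x₂, c₂, r₂, k₂, a₂⟩ := ih₂ ρ v (t + 1) s₁ (by omega)
      (fun i => (hρ i).trans (by omega)) (fun i => by rw [k₁ _ (hρ i), hv])
    have hg : ∀ r < 12, s₁.reg r = s.reg r := fun r hr => k₁ r (by omega)
    rw [cost_congr hg] at c₂
    rw [eval_congr hg a₁] at r₂
    refine ⟨s₂, τ₁ + τ₂, fun q s'' τ' hq => ?_, by omega, by rw [k₂ t (by omega), r₁], r₂,
      fun r hr => by rw [k₂ r (by omega), k₁ r hr], by rw [a₂, a₁]⟩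
    rw [add_assoc]
    exact .seq x₁ (.seq x₂ hq)
  induction e with
  | const c =>
    intro ρ v t s ht hρ hv
    exact ⟨_, _, .assign _ _ _, le_rfl, by simp [State.setReg, eval, Expr.eval],
      fun r hr => by simp [State.setReg, hr.ne], rfl⟩
  | glob g =>
    intro ρ v t s ht hρ hv
    exact ⟨_, _, .assign _ _ _, le_rfl, by simp [State.setReg, eval, Expr.eval],
      fun r hr => by simp [State.setReg, hr.ne], rfl⟩
  | var i =>
    intro ρ v t s ht hρ hv
    exact ⟨_, _, .assign _ _ _, le_rfl, by simp [State.setReg, eval, Expr.eval, hv],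
      fun r hr => by simp [State.setReg, hr.ne], rfl⟩
  | read a e ih =>
    intro ρ v t s ht hρ hv
    obtain ⟨s₁, τ₁, x₁, c₁, r₁, k₁, a₁⟩ := ih ρ v t s ht hρ hv
    exact ⟨_, _, .seq x₁ (.assign _ _ _), by simp only [cost, Expr.cost]; omega,
      by simp [State.setReg, eval, Expr.eval, r₁, a₁],
      fun r hr => by simp [State.setReg, hr.ne, k₁ r hr], a₁⟩
  | add e₁ e₂ ih₁ ih₂ | sub e₁ e₂ ih₁ ih₂ =>
    intro ρ v t s ht hρ hv
    obtain ⟨s₁, τ₁, x₁, c₁, r₁, r₂, k₁, a₁⟩ := binary e₁ e₂ ih₁ ih₂ ρ v t s ht hρ hv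
    exact ⟨_, _, x₁ _ _ _ (.assign _ _ _), by simp only [cost, Expr.cost]; omega,
      by simp [State.setReg, eval, Expr.eval, r₁, r₂],
      fun r hr => by simp [State.setReg, hr.ne, k₁ r hr], a₁⟩
  | ite c e₁ e₂ ih ih₁ ih₂ =>
    intro ρ v t s ht hρ hv
    obtain ⟨s₁, τ₁, x₁, c₁, r₁, k₁, a₁⟩ := ih ρ v t s ht hρ hv
    have hg : ∀ r < 12, s₁.reg r = s.reg r := fun r hr => k₁ r (by omega)
    have hv₁ : ∀ i, s₁.reg (ρ i) = v i := fun i => by rw [k₁ _ (hρ i), hv]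
    by_cases hc : c.eval s v = 0
    · obtain ⟨s₂, τ₂, x₂, c₂, r₂, k₂, a₂⟩ := ih₂ ρ v t s₁ ht hρ hv₁
      rw [cost_congr hg] at c₂
      rw [eval_congr hg a₁] at r₂
      exact ⟨_, _, .seq x₁ (.ite_false (by simp [Expr.eval, r₁, hc]) x₂),
        by simp only [cost, Expr.cost]; omega, by simp [r₂, eval, hc],
        fun r hr => by rw [k₂ r hr, k₁ r hr], by rw [a₂, a₁]⟩
    · obtain ⟨s₂, τ₂, x₂, c₂, r₂, k₂, a₂⟩ := ih₁ ρ v t s₁ ht hρ hv₁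
      rw [cost_congr hg] at c₂
      rw [eval_congr hg a₁] at r₂
      exact ⟨_, _, .seq x₁ (.ite_true (by simp [Expr.eval, r₁, hc]) x₂),
        by simp only [cost, Expr.cost]; omega, by simp [r₂, eval, hc],
        fun r hr => by rw [k₂ r hr, k₁ r hr], by rw [a₂, a₁]⟩
  | sum g e ih =>
    intro ρ v t s ht hρ hv
    -- Here `j` rounds are done and `m` remain. Besides the body, a round takes 4 steps for the test
    -- and 4 for each of the two assignments, hence `12`; the last, failing test takes 4.
    have hloop : ∀ (m j : ℕ) (s₁ : State), m + j = s.reg (g + 3) → s₁.reg (t + 1) = j →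
        (∀ r < t, s₁.reg r = s.reg r) → s₁.arr = s.arr →
        ∃ s' τ, Exec (.loop (.sub (.reg (g + 3)) (.reg (t + 1)))
          (.seq (e.comp (scons (t + 1) ρ) (t + 2))
            (.seq (.assign t (.add (.reg t) (.reg (t + 2))))
              (.assign (t + 1) (.add (.reg (t + 1)) (.const 1)))))) s₁ s' τ ∧
          τ ≤ m * (e.cost s.reg + 12) + 4 ∧
          s'.reg t = s₁.reg t + ∑ i ∈ Finset.range m, e.eval s (scons (j + i) v) ∧
          (∀ r < t, s'.reg r = s.reg r) ∧ s'.arr = s.arr := by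
      intro m
      induction m with
      | zero =>
        intro j s₁ hj h₁ hk ha
        refine ⟨s₁, _, .loop_done ?_, by simp [Expr.cost], by simp, hk, ha⟩
        simp only [Expr.eval, h₁, hk (g + 3) (by omega)]
        omega
      | succ m ihm =>
        intro j s₁ hj h₁ hk ha
        have hg : ∀ r < 12, s₁.reg r = s.reg r := fun r hr => hk r (by omega)
        obtain ⟨s₂, τ₂, x₂, c₂, r₂, k₂, a₂⟩ := ih (scons (t + 1) ρ) (scons j v) (t + 2) s₁
          (by omega) (by
            rintro (_ | i)
            · simp [scons]
            · exact (hρ i).trans (by omega)) (by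
            rintro (_ | i)
            · exact h₁
            · exact (hk _ (hρ i)).trans (hv i))
        rw [cost_congr hg] at c₂
        rw [eval_congr hg ha] at r₂
        obtain ⟨s₃, τ₃, x₃, c₃, r₃, k₃, a₃⟩ := ihm (j + 1)
          ((s₂.setReg t (s₂.reg t + s₂.reg (t + 2))).setReg (t + 1) (j + 1)) (by omega)
          (by simp [State.setReg])
          (fun r hr => by
            simp only [State.setReg]
            rw [Function.update_of_ne (by omega), Function.update_of_ne (by omega),
              k₂ r (by omega), hk r hr])
          (by simp only [State.setReg, a₂, ha])
        have y := Exec.assign (s₂.setReg t (s₂.reg t + s₂.reg (t + 2))) (t + 1)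
          (.add (.reg (t + 1)) (.const 1))
        have hval : (Expr.add (.reg (t + 1)) (.const 1)).eval
            (s₂.setReg t (s₂.reg t + s₂.reg (t + 2))) = j + 1 := by
          simp [Expr.eval, State.setReg, k₂ (t + 1) (by omega), h₁]
        rw [hval] at y
        refine ⟨s₃, _, .loop_step ?_ (.seq x₂ (.seq (.assign _ _ _) y)) x₃, ?_, ?_, k₃, a₃⟩
        · simp only [Expr.eval, h₁, hk (g + 3) (by omega)]
          omega
        · simp only [Expr.cost]
          rw [add_mul]
          omega
        · rw [r₃, Finset.sum_range_succ']
          simp only [State.setReg]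
          rw [Function.update_of_ne (by omega), Function.update_self, r₂, k₂ t (by omega)]
          have : ∀ i, j + 1 + i = j + (i + 1) := fun i => by omega
          simp only [this, add_zero]
          omega
    obtain ⟨s', τ, x, c, r, k, a⟩ := hloop (s.reg (g + 3)) 0
      ((s.setReg t 0).setReg (t + 1) 0) (by omega) (by simp [State.setReg])
      (fun r hr => by
        simp only [State.setReg]
        rw [Function.update_of_ne (by omega), Function.update_of_ne (by omega)]) rfl
    refine ⟨s', _, .seq (.assign _ _ _) (.seq (.assign _ _ _) x), ?_, ?_, k, a⟩
    · simp only [cost, Expr.cost]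
      omega
    · rw [r]
      simp [State.setReg, eval]

end Term

/-! ### Straight-line programs over terms -/

/-- Commands: set a global register, or tabulate a term in an array from index `0` upwards. -/
inductive Cmd where
  | set (g : Fin 12) (e : Term)
  | fill (a : ℕ) (g : Fin 9) (e : Term)

namespace Cmd

/-- The effect of tabulating the first `m` values of `e` in array `a`. -/
def tabulate (a : ℕ) (e : Term) (s : State) : ℕ → State
  | 0 => s
  | m + 1 => (tabulate a e s m).setArr a m (e.eval (tabulate a e s m) fun _ => m)

/-- The effect of a command on the global registers and the arrays. -/
def run (s : State) : Cmd → State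
  | set g e => s.setReg g (e.eval s fun _ => 0)
  | fill a g e => tabulate a e s (s.reg (g + 3))

/-- An upper bound for the number of steps of a command. -/
def cost (r : ℕ → ℕ) : Cmd → ℕ
  | set _ e => e.cost r + 4
  | fill _ g e => r (g + 3) * (e.cost r + 12) + 6

/-- The compiled command. -/
def comp : Cmd → Prog
  | set g e => .seq (.assign 12 (.const 0)) (.seq (e.comp (fun _ => 12) 13) (.assign g (.reg 13)))
  | fill a g e => .seq (.assign 12 (.const 0)) (.loop (.sub (.reg (g + 3)) (.reg 12))
      (.seq (e.comp (fun _ => 12) 13)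
        (.seq (.write a (.reg 12) (.reg 13)) (.assign 12 (.add (.reg 12) (.const 1))))))

/-- Two states with the same arrays and the same global registers. -/
def Agree (s s' : State) : Prop :=
  (∀ r < 12, s.reg r = s'.reg r) ∧ s.arr = s'.arr

theorem tabulate_reg (a : ℕ) (e : Term) (s : State) (m : ℕ) :
    (tabulate a e s m).reg = s.reg := by
  induction m with
  | zero => rfl
  | succ m ih => simpa [tabulate, State.setArr] using ih

theorem tabulate_arr_of_ne (a : ℕ) (e : Term) (s : State) (m : ℕ) {b : ℕ} (h : b ≠ a) :
    (tabulate a e s m).arr b = s.arr b := by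
  induction m with
  | zero => rfl
  | succ m ih => simpa [tabulate, State.setArr, h] using ih

theorem tabulate_arr_of_lt (a : ℕ) (e : Term) (s : State) {i m m' : ℕ} (h : i < m) (h' : i < m') :
    (tabulate a e s m).arr a i = (tabulate a e s m').arr a i := by
  have key : ∀ m, i < m → (tabulate a e s m).arr a i = (tabulate a e s (i + 1)).arr a i := by
    intro m hm
    induction m with
    | zero => omega
    | succ m ih =>
      rcases Nat.lt_succ_iff_lt_or_eq.mp hm with h | rfl
      · rw [← ih h]
        simp [tabulate, State.setArr, Function.update_of_ne h.ne]
      · rfl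
  rw [key m h, key m' h']

/-- When cell `i` is evaluated, exactly the cells below `i` have been refilled. A term may therefore
read earlier cells of its own table, which is how recursions are run. -/
theorem tabulate_arr (a : ℕ) (e : Term) (s : State) {i m : ℕ} (h : i < m) :
    (tabulate a e s m).arr a i = e.eval (tabulate a e s i) fun _ => i := by
  rw [tabulate_arr_of_lt a e s h i.lt_succ_self]
  simp [tabulate, State.setArr]

theorem exec_comp (c : Cmd) {s₀ s : State} (hs : Agree s₀ s) :
    ∃ s' τ, Exec c.comp s₀ s' τ ∧ τ ≤ c.cost s.reg ∧ Agree s' (c.run s) := by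
  cases c with
  | set g e =>
    obtain ⟨s₁, τ₁, x₁, c₁, r₁, k₁, a₁⟩ := e.exec_comp (fun _ => 12) (fun _ => 0) 13
      (s₀.setReg 12 0) (by omega) (by simp) (by simp [State.setReg])
    have hg : ∀ r < 12, (s₀.setReg 12 0).reg r = s.reg r := fun r hr => by
      simp [State.setReg, hr.ne, hs.1 r hr]
    have ha : (s₀.setReg 12 0).arr = s.arr := hs.2
    rw [Term.cost_congr hg] at c₁
    rw [Term.eval_congr hg ha] at r₁
    refine ⟨_, _, .seq (.assign _ _ _) (.seq x₁ (.assign _ _ _)), ?_, fun r hr => ?_, ?_⟩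
    · simp only [cost, Expr.cost]
      omega
    · by_cases h : r = g
      · subst h
        simp [run, State.setReg, Expr.eval, r₁]
      · simp only [run, State.setReg]
        rw [Function.update_of_ne h, Function.update_of_ne h, k₁ r (by omega), hg r hr]
    · simp [run, State.setReg, a₁, hs.2]
  | fill a g e =>
    have hloop : ∀ (m j : ℕ) (s₁ : State), m + j = s.reg (g + 3) → s₁.reg 12 = j →
        Agree s₁ (tabulate a e s j) →
        ∃ s' τ, Exec (.loop (.sub (.reg (g + 3)) (.reg 12))
          (.seq (e.comp (fun _ => 12) 13)
            (.seq (.write a (.reg 12) (.reg 13)) (.assign 12 (.add (.reg 12) (.const 1))))))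
          s₁ s' τ ∧ τ ≤ m * (e.cost s.reg + 12) + 4 ∧ Agree s' (tabulate a e s (j + m)) := by
      intro m
      induction m with
      | zero =>
        intro j s₁ hj h₁ hk
        refine ⟨s₁, _, .loop_done ?_, by simp [Expr.cost], hk⟩
        simp only [Expr.eval, h₁, hk.1 (g + 3) (by omega), tabulate_reg]
        omega
      | succ m ihm =>
        intro j s₁ hj h₁ hk
        obtain ⟨s₂, τ₂, x₂, c₂, r₂, k₂, a₂⟩ := e.exec_comp (fun _ => 12) (fun _ => j) 13 s₁
          (by omega) (by simp) (fun _ => h₁)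
        rw [Term.cost_congr hk.1, tabulate_reg] at c₂
        rw [Term.eval_congr hk.1 hk.2] at r₂
        have hj' : s₂.reg 12 = j := by rw [k₂ 12 (by omega), h₁]
        have y := Exec.write s₂ a (.reg 12) (.reg 13)
        simp only [Expr.eval, r₂, hj'] at y
        have z := Exec.assign (s₂.setArr a j (e.eval (tabulate a e s j) fun _ => j)) 12
          (.add (.reg 12) (.const 1))
        simp only [Expr.eval] at z
        have hj'' : (s₂.setArr a j (e.eval (tabulate a e s j) fun _ => j)).reg 12 = j := hj'
        rw [hj''] at z
        have hk' : Agree ((s₂.setArr a j (e.eval (tabulate a e s j) fun _ => j)).setReg 12 (j + 1))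
            (tabulate a e s (j + 1)) := by
          refine ⟨fun r hr => ?_, ?_⟩
          · simp only [State.setReg, State.setArr, tabulate]
            rw [Function.update_of_ne (by omega), k₂ r (by omega), hk.1 r hr]
          · simp only [State.setReg, State.setArr, tabulate, a₂, hk.2]
        obtain ⟨s₃, τ₃, x₃, c₃, k₃⟩ := ihm (j + 1) _ (by omega) (by simp [State.setReg]) hk'
        refine ⟨s₃, _, .loop_step ?_ (.seq x₂ (.seq y z)) x₃, ?_, ?_⟩
        · simp only [Expr.eval, h₁, hk.1 (g + 3) (by omega), tabulate_reg]
          omega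
        · simp only [Expr.cost]
          rw [add_mul]
          omega
        · rwa [show j + (m + 1) = j + 1 + m by omega]
    obtain ⟨s', τ, x, c, k⟩ := hloop (s.reg (g + 3)) 0 (s₀.setReg 12 0) (by omega)
      (by simp [State.setReg]) ⟨fun r hr => by simp [State.setReg, hr.ne, hs.1 r hr, tabulate],
        hs.2⟩
    refine ⟨s', _, .seq (.assign _ _ _) x, ?_, ?_⟩
    · simp only [cost, Expr.cost]
      omega
    · simpa [run] using k

theorem cost_le (c : Cmd) : ∃ C d : ℕ, ∀ (r : ℕ → ℕ) (M : ℕ), 1 ≤ M →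
    (∀ x, 3 ≤ x → x < 12 → r x ≤ M) → c.cost r ≤ C * M ^ d := by
  cases c with
  | set g e =>
    -- Each `read` adds 3 to the cost, so two of them cover the additional 4 of the command.
    obtain ⟨C, d, h⟩ := (Term.read 0 (.read 0 e)).cost_le
    exact ⟨C, d, fun r M hM hr => le_trans (by simp only [cost, Term.cost]; omega) (h r M hM hr)⟩
  | fill a g e =>
    obtain ⟨C, d, h⟩ := (Term.sum g e).cost_le
    exact ⟨C, d, fun r M hM hr => le_trans (by simp only [cost, Term.cost]; omega) (h r M hM hr)⟩

/-- The compiled sequence of commands. -/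
def compList : List Cmd → Prog
  | [] => .skip
  | c :: l => .seq c.comp (compList l)

/-- The loop bounds stay below `M` while the commands are run. -/
def BoundedBy (M : ℕ) : State → List Cmd → Prop
  | _, [] => True
  | s, c :: l => (∀ x, 3 ≤ x → x < 12 → s.reg x ≤ M) ∧ BoundedBy M (c.run s) l

/-- A sequence of commands runs in polynomial time in the largest loop bound. -/
theorem exec_compList (l : List Cmd) : ∃ C d : ℕ, ∀ (s₀ s : State) (M : ℕ), 1 ≤ M → Agree s₀ s →
    BoundedBy M s l →
    ∃ s' τ, Exec (compList l) s₀ s' τ ∧ τ ≤ C * M ^ d ∧ Agree s' (l.foldl run s) := by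
  induction l with
  | nil => exact ⟨1, 0, fun s₀ s M _ h _ => ⟨_, _, .skip _, by simp, h⟩⟩
  | cons c l ih =>
    obtain ⟨C₁, d₁, h₁⟩ := c.cost_le
    obtain ⟨C₂, d₂, h₂⟩ := ih
    refine ⟨C₁ + C₂, d₁ + d₂, fun s₀ s M hM h hb => ?_⟩
    obtain ⟨s₁, τ₁, x₁, c₁, a₁⟩ := c.exec_comp h
    obtain ⟨s₂, τ₂, x₂, c₂, a₂⟩ := h₂ s₁ (c.run s) M hM a₁ hb.2
    refine ⟨s₂, _, .seq x₁ x₂, ?_, a₂⟩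
    have e₁ := c₁.trans (h₁ s.reg M hM hb.1)
    have e₃ : C₁ * M ^ d₁ ≤ C₁ * M ^ (d₁ + d₂) :=
      Nat.mul_le_mul_left _ (Nat.pow_le_pow_right hM (by omega))
    have e₄ : C₂ * M ^ d₂ ≤ C₂ * M ^ (d₁ + d₂) :=
      Nat.mul_le_mul_left _ (Nat.pow_le_pow_right hM (by omega))
    rw [add_mul]
    omega

end Cmd

end Ram

section ShortestPaths

/-! ### Shortest paths and split vertex deletion sets -/

namespace SimpleGraph

variable {V : Type*} {G : SimpleGraph V}

/-- A shortcut between two positions would shorten the whole walk below the distance of its ends. -/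
theorem Walk.dist_getVert_of_length_eq_dist {x y : V} {p : G.Walk x y}
    (hG : G.Connected) (hp : p.length = G.dist x y) {i j : ℕ} (hij : i ≤ j) (hj : j ≤ p.length) :
    j - i ≤ G.dist (p.getVert i) (p.getVert j) := by
  have h₁ : G.dist x (p.getVert i) ≤ i :=
    (dist_le (p.take i)).trans (by simp)
  have h₂ : G.dist (p.getVert j) y ≤ p.length - j :=
    (dist_le (p.drop j)).trans (by simp)
  have h₃ := hG.dist_triangle (u := x) (v := p.getVert i) (w := y)
  have h₄ := hG.dist_triangle (u := p.getVert i) (v := p.getVert j) (w := y)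
  omega

/-- If the vertices of a set have pairwise distance at most `3`, four vertices contain all
vertices of the set on a given shortest path. -/
theorem Walk.exists_four_of_dist_le_three {x y : V} {p : G.Walk x y} (hG : G.Connected)
    (hp : p.length = G.dist x y) {T : Set V} (hT : ∀ u ∈ T, ∀ w ∈ T, G.dist u w ≤ 3) :
    ∃ f : ℕ → V, ∀ u ∈ p.support, u ∈ T → ∃ r < 4, f r = u := by
  classical
  by_cases h : ∃ i, i ≤ p.length ∧ p.getVert i ∈ T
  -- Count from the first visit to `T`. On a shortest path, a visit `r` positions later is at
  -- distance at least `r` from it, so `r ≤ 3`.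
  · refine ⟨fun r => p.getVert (Nat.find h + r), fun u hu huT => ?_⟩
    obtain ⟨j, rfl, hj⟩ := Walk.mem_support_iff_exists_getVert.mp hu
    have h₁ := Nat.find_min' h ⟨hj, huT⟩
    have h₂ := p.dist_getVert_of_length_eq_dist hG hp h₁ hj
    have h₃ := hT _ (Nat.find_spec h).2 _ huT
    exact ⟨j - Nat.find h, by omega, congrArg p.getVert (Nat.add_sub_of_le h₁)⟩
  · refine ⟨fun _ => x, fun u hu huT => absurd ?_ h⟩
    obtain ⟨j, rfl, hj⟩ := Walk.mem_support_iff_exists_getVert.mp hu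
    exact ⟨j, hj, huT⟩

end SimpleGraph

open SimpleGraph

variable {V : Type*} {G : SimpleGraph V}

/-- In a split graph, the vertices that are not isolated have pairwise distance at most `3`. -/
theorem IsSplitVertexDeletionSet.dist_le_three {S : Set V} (hG : G.Connected)
    (hS : IsSplitVertexDeletionSet G S) {u w u' w' : V} (hu : u ∉ S) (hw : w ∉ S)
    (hu' : u' ∉ S) (hw' : w' ∉ S) (h : G.Adj u u') (h' : G.Adj w w') : G.dist u w ≤ 3 := by
  obtain ⟨C, I, hCI, -, hC, hI⟩ := hS
  -- Of two adjacent vertices at least one is in the clique, so `a` is within 1 of it. Two such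
  -- steps and one clique edge give the bound 3.
  have key : ∀ a b : V, ∀ ha : a ∉ S, b ∉ S → G.Adj a b →
      ∃ c : (Sᶜ : Set V), c ∈ C ∧ G.dist a c ≤ 1 := by
    intro a b ha hb hab
    have h₁ : (⟨a, ha⟩ : (Sᶜ : Set V)) ∈ C ∪ I := hCI ▸ Set.mem_univ _
    have h₂ : (⟨b, hb⟩ : (Sᶜ : Set V)) ∈ C ∪ I := hCI ▸ Set.mem_univ _
    rcases h₁ with h₁ | h₁
    · exact ⟨_, h₁, by simp⟩
    rcases h₂ with h₂ | h₂
    · exact ⟨_, h₂, (dist_eq_one_iff_adj.mpr hab).le⟩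
    · exact absurd hab (hI h₁ h₂ fun h => hab.ne (congrArg Subtype.val h))
  obtain ⟨c, hc, hd⟩ := key u u' hu hu' h
  obtain ⟨c', hc', hd'⟩ := key w w' hw hw' h'
  have hcc : G.dist (c : V) c' ≤ 1 := by
    by_cases e : c = c'
    · simp [e]
    · have ha : G.Adj c c' := hC hc hc' e
      exact (dist_eq_one_iff_adj.mpr ha).le
  have h₁ := hG.dist_triangle (u := u) (v := (c : V)) (w := w)
  have h₂ := hG.dist_triangle (u := (c : V)) (v := (c' : V)) (w := w)
  rw [SimpleGraph.dist_comm] at hd'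
  omega

/-- The infimum is attained because the support of a walk is nonempty. -/
theorem distToPath_le_iff {x y v : V} {P : G.Walk x y} {m : ℕ} :
    distToPath v P ≤ m ↔ ∃ w ∈ P.support, G.dist v w ≤ m := by
  constructor
  · intro h
    have hne : {d : ℕ | ∃ w ∈ P.support, d = G.dist v w}.Nonempty :=
      ⟨G.dist v x, x, P.start_mem_support, rfl⟩
    obtain ⟨w, hw, e⟩ := Nat.sInf_mem hne
    exact ⟨w, hw, e ▸ h⟩
  · rintro ⟨w, hw, h⟩
    refine le_trans (Nat.sInf_le ?_) h
    exact ⟨w, hw, rfl⟩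

theorem hasEccentricityShortestPath_iff {l : ℤ} (hl : 0 ≤ l) :
    HasEccentricityShortestPath G l ↔ ∃ (x y : V) (P : G.Walk x y), P.length = G.dist x y ∧
      ∀ v, ∃ w ∈ P.support, G.dist v w ≤ l.toNat := by
  have key : ∀ (x y : V) (P : G.Walk x y),
      (∀ v : V, (distToPath v P : ℤ) ≤ l) ↔ ∀ v, ∃ w ∈ P.support, G.dist v w ≤ l.toNat :=
    fun x y P => forall_congr' fun v => by rw [← distToPath_le_iff]; omega
  simp only [HasEccentricityShortestPath, IsShortestPath, key]
  exact ⟨fun ⟨x, y, P, h, h'⟩ => ⟨x, y, P, h.2, h'⟩,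
    fun ⟨x, y, P, h, h'⟩ => ⟨x, y, P, ⟨P.isPath_of_length_eq_dist h, h⟩, h'⟩⟩

theorem not_hasEccentricityShortestPath_of_neg {l : ℤ} (hl : l < 0) :
    ¬ HasEccentricityShortestPath G l := by
  rintro ⟨x, y, P, -, h⟩
  have := h x
  omega

/-- A walk dominates all vertices within distance `l` if this can be seen from the marked vertices
`u j` that it visits or to which it is adjacent. -/
def Witnessed (u : ℕ → V) (K l : ℕ) {x y : V} (P : G.Walk x y) (v : V) : Prop :=
  ∃ j < K, (u j ∈ P.support ∧ G.dist v (u j) ≤ l) ∨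
    ((∃ w ∈ P.support, G.Adj w (u j)) ∧ G.dist v (u j) + 1 ≤ l)

theorem Witnessed.exists_dist_le (hG : G.Connected) {u : ℕ → V} {K l : ℕ} {x y : V}
    {P : G.Walk x y} {v : V} (h : Witnessed u K l P v) : ∃ w ∈ P.support, G.dist v w ≤ l := by
  obtain ⟨j, -, ⟨h₁, h₂⟩ | ⟨⟨w, h₁, h₂⟩, h₃⟩⟩ := h
  · exact ⟨_, h₁, h₂⟩
  · refine ⟨w, h₁, ?_⟩
    have := hG.dist_triangle (u := v) (v := u j) (w := w)
    rw [dist_eq_one_iff_adj.mpr h₂.symm] at this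
    omega

/-- Let `p` be a path vertex within `l` of `v`. If `p` is marked, it is the witness. Otherwise all
neighbours of `p` are in `S` and hence marked, and the second vertex of a shortest path from `p` to
`v` is adjacent to `P` and one step closer to `v`. There is no second vertex if `v = p`; then a
neighbour of `p` on `P` serves, which needs `1 ≤ P.length` and `1 ≤ l`. -/
theorem witnessed_of_exists_dist_le (hG : G.Connected) {S : Set V} {u : ℕ → V} {K l : ℕ}
    {x y : V} {P : G.Walk x y} (hu : ∀ s ∈ S, ∃ j < K, u j = s)
    (ht : ∀ t ∈ P.support, t ∉ S → (∃ w ∉ S, G.Adj t w) → ∃ j < K, u j = t)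
    (hl : 1 ≤ l) (hP : 1 ≤ P.length) {v : V} (h : ∃ w ∈ P.support, G.dist v w ≤ l) :
    Witnessed u K l P v := by
  obtain ⟨p, hp, hd⟩ := h
  by_cases h : ∃ j < K, u j = p
  · obtain ⟨j, hj, rfl⟩ := h
    exact ⟨j, hj, .inl ⟨hp, hd⟩⟩
  have hpS : p ∉ S := fun h' => h (hu p h')
  have hN : ∀ w, G.Adj p w → w ∈ S := by
    intro w hw
    by_contra hwS
    exact h (ht p hp hpS ⟨w, hwS, hw⟩)
  by_cases e : v = p
  · subst e
    obtain ⟨w, hw, ha⟩ : ∃ w ∈ P.support, G.Adj v w := by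
      obtain ⟨i, rfl, hi⟩ := Walk.mem_support_iff_exists_getVert.mp hp
      rcases Nat.lt_or_ge i P.length with h' | h'
      · exact ⟨_, P.getVert_mem_support (i + 1), P.adj_getVert_succ h'⟩
      · obtain ⟨j, rfl⟩ : ∃ j, i = j + 1 := ⟨i - 1, by omega⟩
        exact ⟨_, P.getVert_mem_support j, (P.adj_getVert_succ (by omega)).symm⟩
    obtain ⟨j, hj, rfl⟩ := hu w (hN w ha)
    exact ⟨j, hj, .inl ⟨hw, (dist_eq_one_iff_adj.mpr ha).le.trans hl⟩⟩
  · obtain ⟨q, hq⟩ := hG.exists_walk_length_eq_dist p v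
    cases q with
    | nil => exact absurd rfl e
    | cons ha q =>
      rename_i w
      obtain ⟨j, hj, rfl⟩ := hu w (hN w ha)
      refine ⟨j, hj, .inr ⟨⟨p, hp, ha⟩, ?_⟩⟩
      have := dist_le q
      rw [SimpleGraph.dist_comm] at hd
      rw [Walk.length_cons] at hq
      rw [SimpleGraph.dist_comm]
      omega

/-- The criterion that is tested: a path is found from its first vertex `u k` and from marks on
the vertices `u j`, which are the vertices of `S` and five guessed vertices. -/
theorem hasEccentricityShortestPath_iff_witnessed {n : ℕ} {G : SimpleGraph (Fin n)}
    (hG : G.Connected) {S : Set (Fin n)} (hS : IsSplitVertexDeletionSet G S) {l : ℤ} (hl : 0 ≤ l)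
    {k : ℕ} {Γ : Set (ℕ → Fin n)} (hΓ : ∀ u ∈ Γ, ∀ s ∈ S, ∃ j < k, u j = s)
    (hΓ' : ∀ f : ℕ → Fin n, ∃ u ∈ Γ, ∀ j < 5, u (k + j) = f j) :
    HasEccentricityShortestPath G l ↔ ∃ u ∈ Γ, ∃ (y : Fin n) (P : G.Walk (u k) y),
      P.length = G.dist (u k) y ∧
        (n ≤ P.length + 1 ∨ ∀ v, Witnessed u (k + 5) l.toNat P v) := by
  rw [hasEccentricityShortestPath_iff hl]
  constructor
  · rintro ⟨x, y, P, hP, h⟩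
    -- Degenerate cases: with radius `0` the path visits all vertices, and so it does if `n ≤ 1`.
    -- Otherwise a one-vertex path is replaced by an edge at that vertex, which is still a shortest
    -- path and dominates no less.
    obtain ⟨x, y, P, hP, h⟩ : ∃ (x y : Fin n) (P : G.Walk x y), P.length = G.dist x y ∧
        (n ≤ P.length + 1 ∨ 1 ≤ l.toNat ∧ 1 ≤ P.length ∧
          ∀ v, ∃ w ∈ P.support, G.dist v w ≤ l.toNat) := by
      by_cases hl' : l.toNat = 0
      · refine ⟨x, y, P, hP, .inl ?_⟩
        have hsub : (Finset.univ : Finset (Fin n)) ⊆ P.support.toFinset := by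
          intro v _
          obtain ⟨w, hw, hd⟩ := h v
          rw [hl', Nat.le_zero, hG.dist_eq_zero_iff] at hd
          rw [List.mem_toFinset]
          exact hd ▸ hw
        have := (Finset.card_le_card hsub).trans (List.toFinset_card_le _)
        simpa using this
      by_cases hn : n ≤ 1
      · exact ⟨x, y, P, hP, .inl (by omega)⟩
      rcases Nat.eq_zero_or_pos P.length with h0 | h0
      · have : Nontrivial (Fin n) := Fin.nontrivial_iff_two_le.mpr (by omega)
        obtain ⟨w, hw⟩ := hG.preconnected.exists_adj_of_nontrivial x
        refine ⟨x, w, hw.toWalk, by simp [dist_eq_one_iff_adj.mpr hw], .inr ⟨by omega, by simp,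
          fun v => ?_⟩⟩
        obtain ⟨z, hz, hd⟩ := h v
        have hzx : z = x := by
          obtain ⟨i, rfl, hi⟩ := Walk.mem_support_iff_exists_getVert.mp hz
          rw [show i = 0 by omega, Walk.getVert_zero]
        exact ⟨x, by simp, hzx ▸ hd⟩
      · exact ⟨x, y, P, hP, .inr ⟨by omega, h0, h⟩⟩
    obtain ⟨f, hf⟩ := P.exists_four_of_dist_le_three hG hP
      (T := {t | t ∉ S ∧ ∃ w ∉ S, G.Adj t w})
      (fun a ⟨ha, a', ha', haa⟩ b ⟨hb, b', hb', hbb⟩ => hS.dist_le_three hG ha hb ha' hb' haa hbb)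
    -- The five guesses are the start `x` and the four vertices that cover the path vertices with a
    -- neighbour outside `S`, themselves outside `S`.
    obtain ⟨u, hu, huf⟩ := hΓ' fun j => if j = 0 then x else f (j - 1)
    have hux : u k = x := by simpa using huf 0 (by omega)
    subst hux
    refine ⟨u, hu, y, P, hP, h.imp_right fun ⟨h₁, h₂, h₃⟩ v => ?_⟩
    refine witnessed_of_exists_dist_le hG (S := S) (fun s hs => ?_) (fun t ht htS hw => ?_) h₁ h₂
      (h₃ v)
    · obtain ⟨j, hj, e⟩ := hΓ u hu s hs
      exact ⟨j, by omega, e⟩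
    · obtain ⟨r, hr, e⟩ := hf t ht ⟨htS, hw⟩
      exact ⟨k + (r + 1), by omega, by simpa [e] using huf (r + 1) (by omega)⟩
  · rintro ⟨u, -, y, P, hP, h⟩
    refine ⟨_, y, P, hP, fun v => ?_⟩
    rcases h with h | h
    -- A shortest path repeats no vertex, so one with `n` vertices visits them all and dominates for
    -- every radius.
    · have hnd := (P.isPath_of_length_eq_dist hP).support_nodup
      have hc : Fintype.card (Fin n) ≤ P.support.toFinset.card := by
        rw [List.toFinset_card_of_nodup hnd]
        simpa using h
      have := Finset.eq_univ_of_card _ (le_antisymm (Finset.card_le_univ _) hc)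
      have hv : v ∈ P.support := by
        rw [← List.mem_toFinset, this]
        exact Finset.mem_univ _
      exact ⟨v, hv, by simp⟩
    · exact (h v).exists_dist_le hG

end ShortestPaths

namespace Ram.Term

/-! ### Derived terms -/

/-- The term is nonzero. -/
def Holds (s : State) (v : ℕ → ℕ) (e : Term) : Prop := e.eval s v ≠ 0

instance (s : State) (v : ℕ → ℕ) (e : Term) : Decidable (Holds s v e) :=
  inferInstanceAs (Decidable (_ ≠ _))

/-- Rename the variables. -/
def rename (ξ : ℕ → ℕ) : Term → Term
  | const c => const c
  | glob g => glob g
  | var i => var (ξ i)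
  | read a e => read a (e.rename ξ)
  | add e₁ e₂ => add (e₁.rename ξ) (e₂.rename ξ)
  | sub e₁ e₂ => sub (e₁.rename ξ) (e₂.rename ξ)
  | ite c e₁ e₂ => ite (c.rename ξ) (e₁.rename ξ) (e₂.rename ξ)
  | sum g e => sum g (e.rename (scons 0 fun i => ξ i + 1))

theorem eval_rename (s : State) (e : Term) (ξ v : ℕ → ℕ) :
    (e.rename ξ).eval s v = e.eval s (v ∘ ξ) := by
  induction e generalizing ξ v with
  | const | glob | var => rfl
  | read a e ih => simp only [rename, eval, ih]
  | add _ _ ih₁ ih₂ | sub _ _ ih₁ ih₂ => simp only [rename, eval, ih₁, ih₂]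
  | ite _ _ _ ih₁ ih₂ ih₃ => simp only [rename, eval, ih₁, ih₂, ih₃]
  | sum g e ih =>
    simp only [rename, eval, ih]
    refine Finset.sum_congr rfl fun j _ => congrArg (fun w => e.eval s w) (funext fun i => ?_)
    cases i <;> rfl

/-- The term under one more bound variable. -/
def shift (e : Term) : Term := e.rename (· + 1)

@[simp] theorem eval_shift (s : State) (e : Term) (j : ℕ) (v : ℕ → ℕ) :
    e.shift.eval s (scons j v) = e.eval s v :=
  eval_rename s e _ _

/-- Negation. -/
def not (a : Term) : Term := sub (const 1) a
/-- Comparison. -/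
def le (a b : Term) : Term := not (sub a b)
/-- Strict comparison. -/
def lt (a b : Term) : Term := le (add a (const 1)) b
/-- Conjunction. -/
def and (a b : Term) : Term := ite a b (const 0)
/-- Disjunction. -/
def or (a b : Term) : Term := add a b
/-- Equality. -/
def eq (a b : Term) : Term := and (le a b) (le b a)
/-- Bounded universal quantification. -/
def all (g : Fin 9) (a : Term) : Term := not (sum g (not a))

variable {s : State} {v : ℕ → ℕ} {a b : Term}

theorem holds_not : Holds s v (not a) ↔ ¬ Holds s v a := by
  simp only [Holds, not, eval]
  omega

theorem holds_le : Holds s v (le a b) ↔ a.eval s v ≤ b.eval s v := by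
  rw [le, holds_not]
  simp only [Holds, eval]
  omega

theorem holds_lt : Holds s v (lt a b) ↔ a.eval s v < b.eval s v := holds_le

theorem holds_and : Holds s v (and a b) ↔ Holds s v a ∧ Holds s v b := by
  simp [Holds, and, eval]

theorem holds_or : Holds s v (or a b) ↔ Holds s v a ∨ Holds s v b := by
  simp only [Holds, or, eval]
  omega

theorem holds_eq : Holds s v (eq a b) ↔ a.eval s v = b.eval s v := by
  rw [eq, holds_and, holds_le, holds_le, le_antisymm_iff]

/-- A sum of natural numbers is nonzero exactly if a summand is, so bounded sums act as bounded
existential quantifiers. -/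
theorem holds_sum {g : Fin 9} :
    Holds s v (sum g a) ↔ ∃ j < s.reg (g + 3), Holds s (scons j v) a := by
  simp [Holds, eval]

theorem holds_all {g : Fin 9} :
    Holds s v (all g a) ↔ ∀ j < s.reg (g + 3), Holds s (scons j v) a := by
  simp [all, holds_not, holds_sum]

theorem eval_ite {c : Term} :
    (ite c a b).eval s v = if Holds s v c then a.eval s v else b.eval s v := rfl

theorem holds_ite {c : Term} :
    Holds s v (ite c a b) ↔ if Holds s v c then Holds s v a else Holds s v b := by
  rw [Holds, eval_ite]
  split_ifs <;> rfl

/-- Multiplication, correct if the first factor is at most the content of register `9`. -/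
def mul (a b : Term) : Term := sum 6 (ite (lt (var 0) a.shift) b.shift (const 0))
/-- Division, correct if the numerator is at most the content of register `9`. -/
def div (a b : Term) : Term := sum 6 (le (mul (add (var 0) (const 1)) b.shift) a.shift)
/-- Remainder, correct if the numerator is at most the content of register `9`. -/
def mod (a b : Term) : Term := sub a (mul (div a b) b)

theorem eval_mul (h : a.eval s v ≤ s.reg 9) :
    (mul a b).eval s v = a.eval s v * b.eval s v := by
  have : ∀ j, ((ite (lt (var 0) a.shift) b.shift (const 0)).eval s (scons j v)) =
      if j < a.eval s v then b.eval s v else 0 := by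
    intro j
    simp only [eval_ite, holds_lt, eval_shift]
    rfl
  rw [mul, eval]
  simp only [this]
  rw [← Finset.sum_filter, Finset.sum_const, smul_eq_mul]
  congr 1
  rw [show (Finset.range (s.reg ((6 : Fin 9) + 3))).filter (· < a.eval s v) =
    Finset.range (a.eval s v) from ?_, Finset.card_range]
  ext j
  simp only [Finset.mem_filter, Finset.mem_range]
  exact ⟨fun h' => h'.2, fun h' => ⟨h'.trans_le h, h'⟩⟩

theorem eval_le_term : (le a b).eval s v = if a.eval s v ≤ b.eval s v then 1 else 0 := by
  simp only [le, not, eval]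
  split <;> omega

/-- The quotient of `a` by `b` is the number of `j` with `(j + 1) * b ≤ a`, and all of them are
below the loop bound in register `9`. -/
theorem eval_div (h : a.eval s v ≤ s.reg 9) (hb : 0 < b.eval s v) :
    (div a b).eval s v = a.eval s v / b.eval s v := by
  have : ∀ j ∈ Finset.range (s.reg 9),
      (le (mul (add (var 0) (const 1)) b.shift) a.shift).eval s (scons j v) =
      if j < a.eval s v / b.eval s v then 1 else 0 := by
    intro j hj
    have hj' : (add (var 0) (const 1)).eval s (scons j v) ≤ s.reg 9 := Finset.mem_range.mp hj
    simp only [eval_le_term, eval_mul hj', eval_shift, ← Nat.le_div_iff_mul_le hb]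
    rfl
  rw [div, eval]
  refine (Finset.sum_congr rfl this).trans ?_
  rw [← Finset.sum_filter, Finset.sum_const, smul_eq_mul, mul_one,
    show (Finset.range (s.reg 9)).filter (· < a.eval s v / b.eval s v) =
    Finset.range (a.eval s v / b.eval s v) from ?_, Finset.card_range]
  ext j
  simp only [Finset.mem_filter, Finset.mem_range]
  exact ⟨fun h' => h'.2, fun h' => ⟨h'.trans_le ((Nat.div_le_self _ _).trans h), h'⟩⟩

theorem eval_mod (h : a.eval s v ≤ s.reg 9) (hb : 0 < b.eval s v) :
    (mod a b).eval s v = a.eval s v % b.eval s v := by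
  have h' := eval_div h hb
  rw [mod, eval, eval_mul (h' ▸ (Nat.div_le_self _ _).trans h), h']
  have := Nat.div_add_mod' (a.eval s v) (b.eval s v)
  omega

end Ram.Term

/-! ### Numbers as digit sequences -/

/-- Removing the last mixed radix digit. -/
theorem mul_add_div_mod {a b c : ℕ} (h : c < b) : (a * b + c) / b = a ∧ (a * b + c) % b = c := by
  constructor
  · rw [mul_comm, Nat.mul_add_div (by omega), Nat.div_eq_of_lt h, add_zero]
  · rw [Nat.mul_add_mod', Nat.mod_eq_of_lt h]

theorem mul_add_lt {a b c d : ℕ} (h : a < d) (h' : c < b) : a * b + c < d * b := by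
  have := Nat.mul_le_mul_right b h
  rw [Nat.succ_mul] at this
  omega

/-- Used in base `n` to encode a guess of five vertices and in base `2` to encode a set of mark
bits. -/
theorem exists_lt_pow_digits {b : ℕ} (m : ℕ) (f : ℕ → ℕ) (hf : ∀ j, f j < b) :
    ∃ w < b ^ m, ∀ j < m, w / b ^ j % b = f j := by
  induction m generalizing f with
  | zero => exact ⟨0, by simp, by simp⟩
  | succ m ih =>
    obtain ⟨w, hw, h⟩ := ih (fun j => f (j + 1)) fun j => hf (j + 1)
    refine ⟨w * b + f 0, ?_, ?_⟩
    · rw [pow_succ]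
      exact mul_add_lt hw (hf 0)
    · rintro (_ | j) hj
      · rw [pow_zero, Nat.div_one, (mul_add_div_mod (hf 0)).2]
      · rw [pow_succ', ← Nat.div_div_eq_div_mul]
        rw [(mul_add_div_mod (hf 0)).1]
        exact h j (by omega)

namespace Ram.Term

/-! ### The terms of the algorithm

Register `3` holds the number `n` of vertices, `4` the number `2`, `5` the size `k` of the deletion
set, `6` the number `2 * (k + 5)` of mark bits, `7` the number of sets of mark bits, `8` the number
`n ^ 5` of guesses, `9` an upper bound for all these, and `10` the number `k + 5` of marked
vertices. Arrays `2` and `3` hold the powers of `2` and `n`, array `4` the distances, array `5` the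
path table. -/

/-- Adjacency of two vertices. -/
def adj (x y : Term) : Term := read 0 (add (mul x (glob 3)) y)

/-- The distance of two vertices is at most `t`. -/
def distLe (t x y : Term) : Term := read 4 (add (mul (add (mul t (glob 3)) x) (glob 3)) y)

/-- Bit `j` of the number `w`. -/
def bit (w j : Term) : Term := mod (div w (read 2 j)) (glob 4)

/-- The number of elements of the deletion set below `x`. -/
def rank (x : Term) : Term := sum 0 (ite (lt (var 0) x.shift) (read 1 (var 0)) (const 0))

/-- The element of rank `j` of the deletion set. -/
def select (j : Term) : Term :=
  sum 0 (ite (and (read 1 (var 0)) (eq (rank (var 0)) j.shift)) (var 0) (const 0))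

/-- The marked vertex number `j`, for the guess `g`. -/
def marked (g j : Term) : Term :=
  let a := ite (lt j (glob 5)) (select j) (mod (div g (read 3 (sub j (glob 5)))) (glob 3))
  ite (lt a (glob 3)) a (const 0)

/-- The vertex `x` sets bit `j`. -/
def marks (g j x : Term) : Term :=
  ite (lt j (glob 10)) (eq x (marked g j)) (adj x (marked g (sub j (glob 10))))

/-- The entry of the path table for length `i`, guess `g`, last vertex `x`, mark bits `w`. -/
def table (i g x w : Term) : Term :=
  read 5 (add (mul (add (mul (add (mul i (glob 8)) g) (glob 3)) x) (glob 7)) w)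

/-- Every mark bit that is set in `w` is set in `w'` or set by the vertex `x`. -/
def transition (g x w w' : Term) : Term :=
  all 3 (or (not (bit w.shift (var 0)))
    (or (bit w'.shift (var 0)) (marks g.shift (var 0) x.shift)))

/-- The distance table. -/
def distTable : Term :=
  let y := mod (var 0) (glob 3)
  let x := mod (div (var 0) (glob 3)) (glob 3)
  let t := div (div (var 0) (glob 3)) (glob 3)
  ite t (sum 0 (and (distLe (sub t.shift (const 1)) x.shift (var 0))
      (or (eq (var 0) y.shift) (adj (var 0) y.shift))))
    (eq x y)

/-- The path table. -/
def pathTable : Term :=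
  let w := mod (var 0) (glob 7)
  let x := mod (div (var 0) (glob 7)) (glob 3)
  let g := mod (div (div (var 0) (glob 7)) (glob 3)) (glob 8)
  let i := div (div (div (var 0) (glob 7)) (glob 3)) (glob 8)
  ite i (sum 0 (sum 4 (and
      (table (sub i.shift.shift (const 1)) g.shift.shift (var 1) (var 0))
      (and (adj (var 1) x.shift.shift)
        (transition g.shift.shift x.shift.shift w.shift.shift (var 0))))))
    (and (eq x (marked g (glob 5))) (transition g x w (const 0)))

/-- The distance of two vertices plus `c` is at most the radius. -/
def within (c x y : Term) : Term :=
  sum 0 (and (le (add (var 0) c.shift) (glob 1)) (distLe (var 0) x.shift y.shift))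

/-- The answer. -/
def answer : Term :=
  and (le (glob 2) (const 0)) (sum 0 (sum 5 (sum 0 (sum 4 (and
    (table (var 3) (var 2) (var 1) (var 0)) (and
    (all 0 (or (not (distLe (var 0) (marked (var 3) (glob 5)) (var 2))) (le (var 4) (var 0))))
    (or (le (glob 3) (add (var 3) (const 1)))
      (all 0 (sum 7 (or
        (and (bit (var 2) (var 0)) (within (const 0) (var 1) (marked (var 4) (var 0))))
        (and (bit (var 2) (add (var 0) (glob 10)))
          (within (const 1) (var 1) (marked (var 4) (var 0))))))))))))))

/-- The number `0, …, k - 1` of an element in the deletion set. -/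
def rankOf {n : ℕ} (S : Finset (Fin n)) (x : ℕ) : ℕ :=
  ∑ y ∈ Finset.range n, if y < x then (if ∃ i ∈ S, y = (i : ℕ) then 1 else 0) else 0

/-- The number that `marked` evaluates to. -/
def markedValue {n : ℕ} (S : Finset (Fin n)) (g j : ℕ) : ℕ :=
  let a := if j < S.card then
      ∑ x ∈ Finset.range n, if (∃ i ∈ S, x = (i : ℕ)) ∧ rankOf S x = j then x else 0
    else g / n ^ (j - S.card) % n
  if a < n then a else 0

theorem markedValue_lt {n : ℕ} (hn : 0 < n) (S : Finset (Fin n)) (g j : ℕ) :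
    markedValue S g j < n := by
  rw [markedValue]
  split_ifs with h <;> assumption

theorem rankOf_lt_rankOf {n : ℕ} {S : Finset (Fin n)} {x : Fin n} (hx : x ∈ S) {y : ℕ}
    (h : (x : ℕ) < y) : rankOf S x < rankOf S y := by
  refine Finset.sum_lt_sum (fun z _ => ?_) ⟨x, Finset.mem_range.mpr x.isLt, ?_⟩
  · split_ifs <;> omega
  · rw [if_neg (lt_irrefl _), if_pos h, if_pos ⟨x, hx, rfl⟩]
    exact Nat.one_pos

theorem sum_indicator {n : ℕ} (S : Finset (Fin n)) :
    (∑ y ∈ Finset.range n, if ∃ i ∈ S, y = (i : ℕ) then 1 else 0) = S.card := by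
  rw [← Finset.sum_filter, Finset.sum_const, smul_eq_mul, mul_one,
    ← Finset.card_map Fin.valEmbedding (s := S)]
  congr 1
  ext y
  simp only [Finset.mem_filter, Finset.mem_range, Finset.mem_map, Fin.valEmbedding_apply]
  exact ⟨fun ⟨_, i, h, e⟩ => ⟨i, h, e.symm⟩, fun ⟨i, h, e⟩ => ⟨e ▸ i.isLt, i, h, e.symm⟩⟩

theorem rankOf_lt_card {n : ℕ} {S : Finset (Fin n)} {x : Fin n} (hx : x ∈ S) :
    rankOf S x < S.card := by
  rw [← sum_indicator S]
  refine Finset.sum_lt_sum (fun z _ => ?_) ⟨x, Finset.mem_range.mpr x.isLt, ?_⟩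
  · split_ifs <;> omega
  · rw [if_neg (lt_irrefl _), if_pos ⟨x, hx, rfl⟩]
    exact Nat.one_pos

/-- The rank is strictly increasing on `S`, so only `x` itself contributes to the sum that selects
the element of its rank. -/
theorem markedValue_rankOf {n : ℕ} {S : Finset (Fin n)} {x : Fin n} (hx : x ∈ S) (g : ℕ) :
    markedValue S g (rankOf S x) = x := by
  have : (∑ y ∈ Finset.range n,
      if (∃ i ∈ S, y = (i : ℕ)) ∧ rankOf S y = rankOf S x then y else 0) = x := by
    rw [Finset.sum_eq_single (x : ℕ)]
    · exact if_pos ⟨⟨x, hx, rfl⟩, rfl⟩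
    · intro y _ hy
      refine if_neg ?_
      rintro ⟨⟨i, hi, rfl⟩, h⟩
      rcases lt_or_gt_of_ne hy with h' | h'
      · exact (rankOf_lt_rankOf hi h').ne h
      · exact (rankOf_lt_rankOf hx h').ne h.symm
    · intro h
      exact absurd (Finset.mem_range.mpr x.isLt) h
  rw [markedValue]
  simp only [if_pos (rankOf_lt_card hx), this, if_pos x.isLt]

theorem markedValue_card_add {n : ℕ} (hn : 0 < n) (S : Finset (Fin n)) (g j : ℕ) :
    markedValue S g (S.card + j) = g / n ^ j % n := by
  rw [markedValue]
  simp only [if_neg (show ¬ S.card + j < S.card by omega), Nat.add_sub_cancel_left,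
    if_pos (Nat.mod_lt _ hn)]

/-- The marked vertices. -/
def markedVertex {n : ℕ} (hn : 0 < n) (S : Finset (Fin n)) (g j : ℕ) : Fin n :=
  ⟨markedValue S g j, markedValue_lt hn S g j⟩

theorem exists_markedVertex_eq {n : ℕ} (hn : 0 < n) {S : Finset (Fin n)} (g : ℕ) {x : Fin n}
    (hx : x ∈ S) : ∃ j < S.card, markedVertex hn S g j = x :=
  ⟨_, rankOf_lt_card hx, Fin.ext (markedValue_rankOf hx g)⟩

theorem exists_guess {n : ℕ} (hn : 0 < n) (S : Finset (Fin n)) (f : ℕ → Fin n) :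
    ∃ g < n ^ 5, ∀ j < 5, markedVertex hn S g (S.card + j) = f j := by
  obtain ⟨g, hg, h⟩ := exists_lt_pow_digits 5 (fun j => (f j : ℕ)) fun j => (f j).isLt
  exact ⟨g, hg, fun j hj => Fin.ext ((markedValue_card_add hn S g j).trans (h j hj))⟩

/-! ### Evaluation of the terms -/

/-- The state after the preparations. -/
structure Ready {n : ℕ} (G : SimpleGraph (Fin n)) (S : Finset (Fin n)) (s : State) : Prop where
  pos : 0 < n
  reg3 : s.reg 3 = n
  reg4 : s.reg 4 = 2
  reg5 : s.reg 5 = S.card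
  reg6 : s.reg 6 = 2 * (S.card + 5)
  reg7 : s.reg 7 = 2 ^ (2 * (S.card + 5))
  reg8 : s.reg 8 = n ^ 5
  reg9 : s.reg 9 = n * n ^ 5 * n * 2 ^ (2 * (S.card + 5))
  reg10 : s.reg 10 = S.card + 5
  arr0 : ∀ x y : Fin n, s.arr 0 (x * n + y) ≠ 0 ↔ G.Adj x y
  arr1 : ∀ x, s.arr 1 x = if ∃ i ∈ S, x = (i : ℕ) then 1 else 0
  arr2 : ∀ j < 2 * (S.card + 5), s.arr 2 j = 2 ^ j
  arr3 : ∀ j < 2 * (S.card + 5), s.arr 3 j = n ^ j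

namespace Ready

variable {n : ℕ} {G : SimpleGraph (Fin n)} {S : Finset (Fin n)} {s : State} (h : Ready G S s)
  {v : ℕ → ℕ} {a b c d : Term}

include h

theorem tabulate {a : ℕ} (ha : 3 < a) (e : Term) (m : ℕ) : Ready G S (Cmd.tabulate a e s m) where
  pos := h.pos
  reg3 := by rw [Cmd.tabulate_reg, h.reg3]
  reg4 := by rw [Cmd.tabulate_reg, h.reg4]
  reg5 := by rw [Cmd.tabulate_reg, h.reg5]
  reg6 := by rw [Cmd.tabulate_reg, h.reg6]
  reg7 := by rw [Cmd.tabulate_reg, h.reg7]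
  reg8 := by rw [Cmd.tabulate_reg, h.reg8]
  reg9 := by rw [Cmd.tabulate_reg, h.reg9]
  reg10 := by rw [Cmd.tabulate_reg, h.reg10]
  arr0 := by rw [Cmd.tabulate_arr_of_ne _ _ _ _ (by omega)]; exact h.arr0
  arr1 := by rw [Cmd.tabulate_arr_of_ne _ _ _ _ (by omega)]; exact h.arr1
  arr2 := by rw [Cmd.tabulate_arr_of_ne _ _ _ _ (by omega)]; exact h.arr2
  arr3 := by rw [Cmd.tabulate_arr_of_ne _ _ _ _ (by omega)]; exact h.arr3

/-- These bounds meet the side conditions of `eval_mul`, `eval_div` and `eval_mod` wherever table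
indices are formed or decoded. -/
theorem le_reg9 : n * n ^ 5 * n ≤ s.reg 9 ∧ n ^ 5 ≤ s.reg 9 ∧ n * n * n ≤ s.reg 9 ∧
    n * n ≤ s.reg 9 ∧ n ≤ s.reg 9 ∧ 2 ^ (2 * (S.card + 5)) ≤ s.reg 9 := by
  rw [h.reg9]
  have h₁ : 1 ≤ 2 ^ (2 * (S.card + 5)) := Nat.one_le_two_pow
  have h₂ := h.pos
  have h₃ : 1 ≤ n ^ 4 := Nat.one_le_pow _ _ h₂
  have key : ∀ a b : ℕ, 1 ≤ b → a ≤ a * b := fun a b hb => Nat.le_mul_of_pos_right a hb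
  refine ⟨key _ _ h₁, ?_, ?_, ?_, ?_, ?_⟩
  · calc n ^ 5 ≤ n ^ 5 * (n * n * 2 ^ (2 * (S.card + 5))) := key _ _ (Nat.succ_le_of_lt (by positivity))
      _ = _ := by ring
  · calc n * n * n ≤ n * n * n * (n ^ 4 * 2 ^ (2 * (S.card + 5))) := key _ _ (Nat.succ_le_of_lt (by positivity))
      _ = _ := by ring
  · calc n * n ≤ n * n * (n * n ^ 4 * 2 ^ (2 * (S.card + 5))) := key _ _ (Nat.succ_le_of_lt (by positivity))
      _ = _ := by ring
  · calc n ≤ n * (n * n * n ^ 4 * 2 ^ (2 * (S.card + 5))) := key _ _ (Nat.succ_le_of_lt (by positivity))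
      _ = _ := by ring
  · calc 2 ^ (2 * (S.card + 5)) ≤ 2 ^ (2 * (S.card + 5)) * (n * n ^ 5 * n) :=
          key _ _ (Nat.succ_le_of_lt (by positivity))
      _ = _ := by ring

theorem holds_adj {x y : Fin n} (ha : a.eval s v = x) (hb : b.eval s v = y) :
    Holds s v (adj a b) ↔ G.Adj x y := by
  have := h.le_reg9
  have h3 : (glob 3).eval s v = n := h.reg3
  rw [← h.arr0, Holds, adj, eval, eval, eval_mul (by rw [ha]; omega), ha, hb, h3]

theorem eval_bit (ha : a.eval s v ≤ s.reg 9) (hb : b.eval s v < 2 * (S.card + 5)) :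
    (bit a b).eval s v = a.eval s v / 2 ^ b.eval s v % 2 := by
  have hp : (read 2 b).eval s v = 2 ^ b.eval s v := h.arr2 _ hb
  have hp' : 0 < (read 2 b).eval s v := by rw [hp]; positivity
  have h4 : (glob 4).eval s v = 2 := h.reg4
  have hd := eval_div ha hp'
  rw [bit, eval_mod (by rw [hd]; exact (Nat.div_le_self _ _).trans ha) (by omega), hd, hp, h4]

theorem eval_rank : (rank (var 0)).eval s v = rankOf S (v 0) := by
  rw [rank, rankOf, eval, show s.reg ((0 : Fin 9) + 3) = n from h.reg3]
  refine Finset.sum_congr rfl fun y _ => ?_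
  rw [eval_ite, ← h.arr1]
  simp only [holds_lt, eval_shift]
  rfl

theorem eval_marked (ha : a.eval s v ≤ s.reg 9) (hb : b.eval s v < S.card + 5) :
    (marked a b).eval s v = markedVertex h.pos S (a.eval s v) (b.eval s v) := by
  have h3 : ∀ v, (glob 3).eval s v = n := fun _ => h.reg3
  have h5 : ∀ v, (glob 5).eval s v = S.card := fun _ => h.reg5
  have hs : (select b).eval s v = ∑ x ∈ Finset.range n,
      if (∃ i ∈ S, x = (i : ℕ)) ∧ rankOf S x = b.eval s v then x else 0 := by
    rw [select, eval, show s.reg ((0 : Fin 9) + 3) = n from h.reg3]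
    refine Finset.sum_congr rfl fun x _ => ?_
    have h₁ : Holds s (scons x v) (read 1 (var 0)) ↔ ∃ i ∈ S, x = (i : ℕ) := by
      rw [Holds, show (read 1 (var 0)).eval s (scons x v) = s.arr 1 x from rfl, h.arr1]
      split_ifs with h' <;> simp [h']
    simp only [eval_ite, holds_and, holds_eq, h₁, h.eval_rank, eval_shift]
    rfl
  have hd : ¬ b.eval s v < S.card → (mod (div a (read 3 (sub b (glob 5)))) (glob 3)).eval s v =
      a.eval s v / n ^ (b.eval s v - S.card) % n := by
    intro hb'
    have hp : (read 3 (sub b (glob 5))).eval s v = n ^ (b.eval s v - S.card) := by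
      rw [eval, eval, h5]
      exact h.arr3 _ (by omega)
    have hp' : 0 < (read 3 (sub b (glob 5))).eval s v := by
      rw [hp]
      exact Nat.pow_pos h.pos
    have hdiv := eval_div ha hp'
    rw [eval_mod (by rw [hdiv]; exact (Nat.div_le_self _ _).trans ha) (by rw [h3]; exact h.pos),
      hdiv, hp, h3]
  have hi : (ite (lt b (glob 5)) (select b)
      (mod (div a (read 3 (sub b (glob 5)))) (glob 3))).eval s v =
      if b.eval s v < S.card then ∑ x ∈ Finset.range n,
        if (∃ i ∈ S, x = (i : ℕ)) ∧ rankOf S x = b.eval s v then x else 0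
      else a.eval s v / n ^ (b.eval s v - S.card) % n := by
    by_cases hb' : b.eval s v < S.card
    · rw [eval_ite, if_pos hb', if_pos (by rw [holds_lt, h5]; exact hb'), hs]
    · rw [eval_ite, if_neg hb', if_neg (by rw [holds_lt, h5]; exact hb'), hd hb']
  simp only [marked, markedVertex, markedValue]
  rw [eval_ite, hi]
  simp only [holds_lt, hi, h3]
  rfl

end Ready

/-- The vertex `x` sets the mark bit `j`: it is the marked vertex number `j`, or it is adjacent to
the marked vertex number `j - K`. -/
def Marks {V : Type*} (G : SimpleGraph V) (u : ℕ → V) (K j : ℕ) (x : V) : Prop :=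
  if j < K then x = u j else G.Adj x (u (j - K))

/-- There is a walk of length `i` from `u k` to `y` whose vertices set all bits of `w`. -/
def HasMarkedWalk {V : Type*} (G : SimpleGraph V) (u : ℕ → V) (k w i : ℕ) (y : V) : Prop :=
  ∃ p : G.Walk (u k) y, p.length = i ∧
    ∀ j < 2 * (k + 5), w / 2 ^ j % 2 ≠ 0 → ∃ x ∈ p.support, Marks G u (k + 5) j x

/-- Array `4` holds the distances. -/
def DistReady {n : ℕ} (G : SimpleGraph (Fin n)) (s : State) : Prop :=
  ∀ t < n, ∀ x y : Fin n, s.arr 4 ((t * n + x) * n + y) ≠ 0 ↔ G.dist x y ≤ t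

namespace Ready

variable {n : ℕ} {G : SimpleGraph (Fin n)} {S : Finset (Fin n)} {s : State} (h : Ready G S s)
  {v : ℕ → ℕ} {a b c d : Term}

include h

theorem holds_marks {x : Fin n} (ha : a.eval s v ≤ s.reg 9) (hb : b.eval s v < 2 * (S.card + 5))
    (hc : c.eval s v = x) : Holds s v (marks a b c) ↔
      Marks G (markedVertex h.pos S (a.eval s v)) (S.card + 5) (b.eval s v) x := by
  have h10 : (glob 10).eval s v = S.card + 5 := h.reg10
  rw [marks, Marks, holds_ite]
  simp only [holds_lt, h10]
  by_cases hb' : b.eval s v < S.card + 5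
  · rw [if_pos hb', if_pos hb', holds_eq, hc, h.eval_marked ha hb', Fin.ext_iff]
  · rw [if_neg hb', if_neg hb']
    have he : (sub b (glob 10)).eval s v = b.eval s v - (S.card + 5) := by rw [eval, h10]
    rw [h.holds_adj hc (h.eval_marked ha (by rw [he]; omega)), he]

/-- Independent of `DistReady`, because it is also applied while the distance table is still being
filled. -/
theorem holds_distLe_iff {t : ℕ} {x y : Fin n} (ht : t < n)
    (ha : a.eval s v = t) (hb : b.eval s v = x) (hc : c.eval s v = y) :
    Holds s v (distLe a b c) ↔ s.arr 4 ((t * n + x) * n + y) ≠ 0 := by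
  have h3 : (glob 3).eval s v = n := h.reg3
  have hl := h.le_reg9
  have h₁ : (add (mul a (glob 3)) b).eval s v = t * n + x := by
    rw [eval, eval_mul (by rw [ha]; omega), ha, hb, h3]
  have h₂ : t * n + x < n * n := mul_add_lt ht x.isLt
  rw [Holds, distLe, eval, eval, eval_mul (by rw [h₁]; omega), h₁, h3, hc]

theorem holds_distLe (h4 : DistReady G s) {t : ℕ} {x y : Fin n} (ht : t < n)
    (ha : a.eval s v = t) (hb : b.eval s v = x) (hc : c.eval s v = y) :
    Holds s v (distLe a b c) ↔ G.dist x y ≤ t := by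
  rw [h.holds_distLe_iff ht ha hb hc, h4 t ht]

theorem holds_transition {x : Fin n} (ha : a.eval s v < n ^ 5) (hb : b.eval s v = x)
    (hc : c.eval s v ≤ s.reg 9) (hd : d.eval s v ≤ s.reg 9) :
    Holds s v (transition a b c d) ↔ ∀ j < 2 * (S.card + 5), c.eval s v / 2 ^ j % 2 ≠ 0 →
      d.eval s v / 2 ^ j % 2 ≠ 0 ∨
        Marks G (markedVertex h.pos S (a.eval s v)) (S.card + 5) j x := by
  have hl := h.le_reg9
  rw [transition, holds_all, show s.reg ((3 : Fin 9) + 3) = _ from h.reg6]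
  refine forall₂_congr fun j hj => ?_
  have hv : (var 0).eval s (scons j v) = j := rfl
  rw [holds_or, holds_not, holds_or, h.holds_marks (x := x) (by rw [eval_shift]; omega)
    (by rwa [hv]) (by rwa [eval_shift]), Holds, Holds, h.eval_bit (by rwa [eval_shift]) (by rwa [hv]),
    h.eval_bit (by rwa [eval_shift]) (by rwa [hv]), eval_shift, eval_shift, eval_shift, hv,
    ← imp_iff_not_or]

theorem holds_table {i g w : ℕ} {x : Fin n} (hi : i < n) (hg : g < n ^ 5)
    (ha : a.eval s v = i) (hb : b.eval s v = g) (hc : c.eval s v = x) (hd : d.eval s v = w) :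
    Holds s v (table a b c d) ↔
      s.arr 5 (((i * n ^ 5 + g) * n + x) * 2 ^ (2 * (S.card + 5)) + w) ≠ 0 := by
  have h3 : (glob 3).eval s v = n := h.reg3
  have h7 : (glob 7).eval s v = _ := h.reg7
  have h8 : (glob 8).eval s v = _ := h.reg8
  have hl := h.le_reg9
  have h₁ : (add (mul a (glob 8)) b).eval s v = i * n ^ 5 + g := by
    rw [eval, eval_mul (by rw [ha]; omega), ha, hb, h8]
  have h₂ : i * n ^ 5 + g < n * n ^ 5 := mul_add_lt hi hg
  have h₃ : (i * n ^ 5 + g) * n + x < n * n ^ 5 * n := mul_add_lt h₂ x.isLt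
  have h₅ : n * n ^ 5 ≤ n * n ^ 5 * n := Nat.le_mul_of_pos_right _ h.pos
  have h₄ : (add (mul (add (mul a (glob 8)) b) (glob 3)) c).eval s v =
      (i * n ^ 5 + g) * n + x := by
    rw [eval, eval_mul (by rw [h₁]; omega), h₁, h3, hc]
  rw [Holds, table, eval, eval, eval_mul (by rw [h₄]; omega), h₄, h7, hd]

theorem holds_within (h4 : DistReady G s) (hG : G.Connected) {x y : Fin n} {m : ℕ}
    (ha : a.eval s v = m) (hb : b.eval s v = x) (hc : c.eval s v = y) :
    Holds s v (within a b c) ↔ G.dist x y + m ≤ s.reg 1 := by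
  rw [within, holds_sum, show s.reg ((0 : Fin 9) + 3) = _ from h.reg3]
  have key : ∀ t < n, Holds s (scons t v) (and (le (add (var 0) a.shift) (glob 1))
      (distLe (var 0) b.shift c.shift)) ↔ t + m ≤ s.reg 1 ∧ G.dist x y ≤ t := by
    intro t ht
    rw [holds_and, holds_le, h.holds_distLe h4 ht rfl (by rwa [eval_shift]) (by rwa [eval_shift]),
      show (add (var 0) a.shift).eval s (scons t v) = t + a.shift.eval s (scons t v) from rfl,
      eval_shift, ha]
    rfl
  constructor
  · rintro ⟨t, ht, h'⟩
    have := (key t ht).mp h'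
    omega
  · intro h'
    -- A path has fewer than `n` edges, so every distance is a row number of the table and can
    -- itself be taken for `t`.
    obtain ⟨p, hp, hd⟩ := hG.exists_path_of_dist x y
    have hlt : G.dist x y < n := by
      have := hp.length_lt
      rwa [hd, Fintype.card_fin] at this
    exact ⟨_, hlt, (key _ hlt).mpr ⟨h', le_rfl⟩⟩

end Ready
end Ram.Term

namespace Ram.Term

/-! ### The tables -/

/-- The recursion of the distance table: cut the last edge off a shortest walk. -/
theorem _root_.SimpleGraph.Connected.dist_le_succ_iff {V : Type*} {G : SimpleGraph V}
    (hG : G.Connected) {x y : V} {t : ℕ} :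
    G.dist x y ≤ t + 1 ↔ ∃ z, G.dist x z ≤ t ∧ (z = y ∨ G.Adj z y) := by
  constructor
  · intro h
    rcases Nat.lt_or_ge t (G.dist x y) with h' | h'
    · obtain ⟨p, hp⟩ := hG.exists_walk_length_eq_dist y x
      rw [SimpleGraph.dist_comm] at hp
      cases p with
      | nil => simp at h'
      | cons ha p =>
        rename_i z
        refine ⟨z, ?_, .inr ha.symm⟩
        rw [SimpleGraph.Walk.length_cons] at hp
        rw [SimpleGraph.dist_comm]
        have := SimpleGraph.dist_le p
        omega
    · exact ⟨y, h', .inl rfl⟩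
  · rintro ⟨z, hz, rfl | h⟩
    · omega
    · have := hG.dist_triangle (u := x) (v := z) (w := y)
      rw [SimpleGraph.dist_eq_one_iff_adj.mpr h] at this
      omega

theorem if_congr_prop {p q a b c d : Prop} [Decidable p] [Decidable q] (h : p ↔ q) (h₁ : q → (a ↔ c))
    (h₂ : ¬ q → (b ↔ d)) : (if p then a else b) ↔ if q then c else d := by
  by_cases hq : q
  · rw [if_pos (h.mpr hq), if_pos hq, h₁ hq]
  · rw [if_neg (mt h.mp hq), if_neg hq, h₂ hq]

/-! ### The recursion for walks with prescribed marks -/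

section MarkedWalk

variable {V : Type*} {G : SimpleGraph V} {u : ℕ → V} {k w i : ℕ} {y : V}

theorem hasMarkedWalk_zero_iff :
    HasMarkedWalk G u k w 0 y ↔ y = u k ∧
      ∀ j < 2 * (k + 5), w / 2 ^ j % 2 ≠ 0 → Marks G u (k + 5) j y := by
  constructor
  · rintro ⟨p, hp, h⟩
    cases p with
    | nil => exact ⟨rfl, fun j hj hw => by simpa using h j hj hw⟩
    | cons => simp at hp
  · rintro ⟨rfl, h⟩
    exact ⟨.nil, rfl, fun j hj hw => by simpa using h j hj hw⟩

/-- Remove the last edge and let `w'` encode exactly the bits set by the remaining walk; a bit of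
`w` outside `w'` must then be set by `y`. Conversely, appending an edge loses no bit, and only the
bits of `w` are required, so surplus marks do no harm. -/
theorem hasMarkedWalk_succ_iff :
    HasMarkedWalk G u k w (i + 1) y ↔ ∃ x, ∃ w' < 2 ^ (2 * (k + 5)), HasMarkedWalk G u k w' i x ∧
      G.Adj x y ∧ ∀ j < 2 * (k + 5), w / 2 ^ j % 2 ≠ 0 →
        w' / 2 ^ j % 2 ≠ 0 ∨ Marks G u (k + 5) j y := by
  classical
  constructor
  · rintro ⟨p, hp, h⟩
    obtain ⟨x, q, ha, rfl⟩ : ∃ (x : V) (q : G.Walk (u k) x) (ha : G.Adj x y), p = q.concat ha := by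
      cases p with
      | nil => simp at hp
      | cons ha p => exact SimpleGraph.Walk.exists_cons_eq_concat ha p
    obtain ⟨w', hw', hb⟩ := exists_lt_pow_digits (b := 2) (2 * (k + 5))
      (fun j => if ∃ x ∈ q.support, Marks G u (k + 5) j x then 1 else 0)
      fun j => by split_ifs <;> omega
    refine ⟨x, w', hw', ⟨q, by simpa using hp, fun j hj hj' => ?_⟩, ha, fun j hj hj' => ?_⟩
    · rw [hb j hj] at hj'
      by_contra hn
      exact hj' (if_neg hn)
    · rw [hb j hj]
      obtain ⟨z, hz, hm⟩ := h j hj hj'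
      rw [SimpleGraph.Walk.support_concat, List.mem_append, List.mem_singleton] at hz
      rcases hz with hz | rfl
      · left
        rw [if_pos ⟨z, hz, hm⟩]
        exact one_ne_zero
      · exact .inr hm
  · rintro ⟨x, w', -, ⟨q, hq, h⟩, ha, h'⟩
    refine ⟨q.concat ha, by simp [hq], fun j hj hj' => ?_⟩
    rw [SimpleGraph.Walk.support_concat]
    rcases h' j hj hj' with h' | h'
    · obtain ⟨z, hz, hm⟩ := h j hj h'
      exact ⟨z, by simp [hz], hm⟩
    · exact ⟨y, by simp, h'⟩

end MarkedWalk

namespace Ready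

variable {n : ℕ} {G : SimpleGraph (Fin n)} {S : Finset (Fin n)} {s : State} (h : Ready G S s)

include h

/-- The radius `t` is the leading digit of the cell number, so row `t - 1` is complete when row `t`
is filled, and `dist_le_succ_iff` applies. Cells from `n * n * n` on are filled too but play no
role. -/
theorem distReady (hG : G.Connected) : DistReady G (Cmd.tabulate 4 distTable s (s.reg 9)) := by
  -- The state `s'` is the one in which the cell is evaluated; it agrees with the finished table on
  -- all earlier cells.
  have key : ∀ t < n, ∀ x y : Fin n, ∃ s', Ready G S s' ∧
      (∀ i < (t * n + x) * n + y,
        s'.arr 4 i = (Cmd.tabulate 4 distTable s (s.reg 9)).arr 4 i) ∧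
      ((Cmd.tabulate 4 distTable s (s.reg 9)).arr 4 ((t * n + x) * n + y) ≠ 0 ↔
        if t ≠ 0 then ∃ z : Fin n, s'.arr 4 (((t - 1) * n + x) * n + z) ≠ 0 ∧ (z = y ∨ G.Adj z y)
        else x = y) := by
    intro t ht x y
    have hl := h.le_reg9
    have hlt : (t * n + x) * n + y < n * n * n := mul_add_lt (mul_add_lt ht x.isLt) y.isLt
    set m := (t * n + x) * n + y with hm
    have h' : Ready G S (Cmd.tabulate 4 distTable s m) := h.tabulate (by omega) _ _
    refine ⟨_, h', fun i hi => Cmd.tabulate_arr_of_lt _ _ _ hi (by omega), ?_⟩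
    rw [Cmd.tabulate_arr _ _ _ (by omega)]
    set s' := Cmd.tabulate 4 distTable s m
    have h9 : s'.reg 9 = s.reg 9 := congrFun (Cmd.tabulate_reg _ _ _ _) 9
    have v0 : (var 0).eval s' (fun _ => m) = m := rfl
    have h3 : (glob 3).eval s' (fun _ => m) = n := h'.reg3
    have e₁ : (div (var 0) (glob 3)).eval s' (fun _ => m) = t * n + x := by
      rw [eval_div (by rw [v0]; omega) (by rw [h3]; exact h.pos), v0, h3,
        (mul_add_div_mod y.isLt).1]
    have ey : (mod (var 0) (glob 3)).eval s' (fun _ => m) = y := by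
      rw [eval_mod (by rw [v0]; omega) (by rw [h3]; exact h.pos), v0, h3,
        (mul_add_div_mod y.isLt).2]
    have hle : t * n + x ≤ s'.reg 9 := by
      have := Nat.le_mul_of_pos_right (t * n + x) h.pos
      omega
    have ex : (mod (div (var 0) (glob 3)) (glob 3)).eval s' (fun _ => m) = x := by
      rw [eval_mod (by rw [e₁]; omega) (by rw [h3]; exact h.pos), e₁, h3,
        (mul_add_div_mod x.isLt).2]
    have et : (div (div (var 0) (glob 3)) (glob 3)).eval s' (fun _ => m) = t := by
      rw [eval_div (by rw [e₁]; omega) (by rw [h3]; exact h.pos), e₁, h3,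
        (mul_add_div_mod x.isLt).1]
    change Holds s' (fun _ => m) distTable ↔ _
    simp only [distTable]
    rw [holds_ite]
    refine if_congr_prop (by rw [Holds, et]) (fun ht => ?_) fun _ => ?_
    · rw [holds_sum, show s'.reg ((0 : Fin 9) + 3) = n from h'.reg3]
      have e : ∀ z : Fin n, Holds s' (scons z fun _ => m)
          (and (distLe (sub (div (div (var 0) (glob 3)) (glob 3)).shift (const 1))
            (mod (div (var 0) (glob 3)) (glob 3)).shift (var 0))
          (or (eq (var 0) (mod (var 0) (glob 3)).shift)
            (adj (var 0) (mod (var 0) (glob 3)).shift))) ↔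
          s'.arr 4 (((t - 1) * n + x) * n + z) ≠ 0 ∧ (z = y ∨ G.Adj z y) := by
        intro z
        rw [holds_and, holds_or, holds_eq, eval_shift, ey,
          h'.holds_adj (x := z) rfl (by rw [eval_shift, ey]),
          h'.holds_distLe_iff (t := t - 1) (x := x) (y := z) (by omega)
            (by rw [eval, eval_shift, et]; rfl) (by rw [eval_shift, ex]) rfl, Fin.ext_iff]
        rfl
      exact ⟨fun ⟨z, hz, h₁⟩ => ⟨⟨z, hz⟩, (e ⟨z, hz⟩).mp h₁⟩,
        fun ⟨z, h₁⟩ => ⟨z, z.isLt, (e z).mpr h₁⟩⟩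
    · rw [holds_eq, ex, ey, Fin.ext_iff]
  intro t
  induction t with
  | zero =>
    intro ht x y
    obtain ⟨s', -, -, e⟩ := key 0 ht x y
    rw [e, if_neg (by simp), Nat.le_zero, hG.dist_eq_zero_iff]
  | succ t ih =>
    intro ht x y
    obtain ⟨s', -, hs', e⟩ := key (t + 1) ht x y
    rw [e, if_pos (by simp), hG.dist_le_succ_iff]
    refine exists_congr fun z => and_congr_left fun _ => ?_
    rw [Nat.add_sub_cancel, hs' _ (lt_of_lt_of_le (mul_add_lt (d := (t + 1) * n + x) ?_ z.isLt)
      (Nat.le_add_right _ _)), ih (by omega)]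
    have := h.pos
    rw [Nat.add_mul]
    omega

/-- Array `5` holds the path table. -/
def _root_.Ram.Term.PathReady {n : ℕ} (hn : 0 < n) (G : SimpleGraph (Fin n)) (S : Finset (Fin n))
    (s : State) : Prop :=
  ∀ i < n, ∀ g < n ^ 5, ∀ x : Fin n, ∀ w < 2 ^ (2 * (S.card + 5)),
    s.arr 5 (((i * n ^ 5 + g) * n + x) * 2 ^ (2 * (S.card + 5)) + w) ≠ 0 ↔
      HasMarkedWalk G (markedVertex hn S g) S.card w i x

/-- As for the distances, with the length `i` as leading digit: cells for length `i` read only cells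
for length `i - 1`. Register `9` is exactly the number of cells. -/
theorem pathReady : PathReady h.pos G S (Cmd.tabulate 5 pathTable s (s.reg 9)) := by
  have key : ∀ i < n, ∀ g < n ^ 5, ∀ x : Fin n, ∀ w < 2 ^ (2 * (S.card + 5)), ∃ s', Ready G S s' ∧
      (∀ c < ((i * n ^ 5 + g) * n + x) * 2 ^ (2 * (S.card + 5)) + w,
        s'.arr 5 c = (Cmd.tabulate 5 pathTable s (s.reg 9)).arr 5 c) ∧
      ((Cmd.tabulate 5 pathTable s (s.reg 9)).arr 5
          (((i * n ^ 5 + g) * n + x) * 2 ^ (2 * (S.card + 5)) + w) ≠ 0 ↔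
        if i ≠ 0 then ∃ z : Fin n, ∃ w' < 2 ^ (2 * (S.card + 5)),
          s'.arr 5 ((((i - 1) * n ^ 5 + g) * n + z) * 2 ^ (2 * (S.card + 5)) + w') ≠ 0 ∧
          G.Adj z x ∧ ∀ j < 2 * (S.card + 5), w / 2 ^ j % 2 ≠ 0 → w' / 2 ^ j % 2 ≠ 0 ∨
            Marks G (markedVertex h.pos S g) (S.card + 5) j x
        else x = markedVertex h.pos S g S.card ∧ ∀ j < 2 * (S.card + 5), w / 2 ^ j % 2 ≠ 0 →
            Marks G (markedVertex h.pos S g) (S.card + 5) j x) := by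
    intro i hi g hg x w hw
    have hl := h.le_reg9
    have h₁ : i * n ^ 5 + g < n * n ^ 5 := mul_add_lt hi hg
    have h₂ : (i * n ^ 5 + g) * n + x < n * n ^ 5 * n := mul_add_lt h₁ x.isLt
    have h₃ : ((i * n ^ 5 + g) * n + x) * 2 ^ (2 * (S.card + 5)) + w < s.reg 9 := by
      rw [h.reg9]
      exact mul_add_lt h₂ hw
    have h₅ : n * n ^ 5 ≤ n * n ^ 5 * n := Nat.le_mul_of_pos_right _ h.pos
    set m := ((i * n ^ 5 + g) * n + x) * 2 ^ (2 * (S.card + 5)) + w with hm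
    have h' : Ready G S (Cmd.tabulate 5 pathTable s m) := h.tabulate (by omega) _ _
    refine ⟨_, h', fun c hc => Cmd.tabulate_arr_of_lt _ _ _ hc (by omega), ?_⟩
    rw [Cmd.tabulate_arr _ _ _ (by omega)]
    set s' := Cmd.tabulate 5 pathTable s m
    have h9 : s'.reg 9 = s.reg 9 := congrFun (Cmd.tabulate_reg _ _ _ _) 9
    have v0 : (var 0).eval s' (fun _ => m) = m := rfl
    have h3 : (glob 3).eval s' (fun _ => m) = n := h'.reg3
    have h5 : (glob 5).eval s' (fun _ => m) = S.card := h'.reg5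
    have h7 : (glob 7).eval s' (fun _ => m) = 2 ^ (2 * (S.card + 5)) := h'.reg7
    have h8 : (glob 8).eval s' (fun _ => m) = n ^ 5 := h'.reg8
    have p3 : 0 < (glob 3).eval s' (fun _ => m) := by rw [h3]; exact h.pos
    have p7 : 0 < (glob 7).eval s' (fun _ => m) := by rw [h7]; positivity
    have p8 : 0 < (glob 8).eval s' (fun _ => m) := by rw [h8]; exact Nat.pow_pos h.pos
    have e₁ : (div (var 0) (glob 7)).eval s' (fun _ => m) = (i * n ^ 5 + g) * n + x := by
      rw [eval_div (by rw [v0]; omega) p7, v0, h7, (mul_add_div_mod hw).1]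
    have ew : (mod (var 0) (glob 7)).eval s' (fun _ => m) = w := by
      rw [eval_mod (by rw [v0]; omega) p7, v0, h7, (mul_add_div_mod hw).2]
    have e₂ : (div (div (var 0) (glob 7)) (glob 3)).eval s' (fun _ => m) = i * n ^ 5 + g := by
      rw [eval_div (by rw [e₁]; omega) p3, e₁, h3, (mul_add_div_mod x.isLt).1]
    have ex : (mod (div (var 0) (glob 7)) (glob 3)).eval s' (fun _ => m) = x := by
      rw [eval_mod (by rw [e₁]; omega) p3, e₁, h3, (mul_add_div_mod x.isLt).2]
    have ei : (div (div (div (var 0) (glob 7)) (glob 3)) (glob 8)).eval s' (fun _ => m) = i := by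
      rw [eval_div (by rw [e₂]; omega) p8, e₂, h8, (mul_add_div_mod hg).1]
    have eg : (mod (div (div (var 0) (glob 7)) (glob 3)) (glob 8)).eval s' (fun _ => m) = g := by
      rw [eval_mod (by rw [e₂]; omega) p8, e₂, h8, (mul_add_div_mod hg).2]
    change Holds s' (fun _ => m) pathTable ↔ _
    simp only [pathTable]
    generalize mod (var 0) (glob 7) = tw at ew ⊢
    generalize mod (div (var 0) (glob 7)) (glob 3) = tx at ex ⊢
    generalize mod (div (div (var 0) (glob 7)) (glob 3)) (glob 8) = tg at eg ⊢
    generalize div (div (div (var 0) (glob 7)) (glob 3)) (glob 8) = ti at ei ⊢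
    rw [holds_ite]
    refine if_congr_prop (by rw [Holds, ei]) (fun ht => ?_) fun _ => ?_
    · have e : ∀ z : Fin n, ∀ w' < 2 ^ (2 * (S.card + 5)),
          Holds s' (scons w' (scons z fun _ => m)) (and
            (table (sub ti.shift.shift (const 1)) tg.shift.shift (var 1) (var 0))
            (and (adj (var 1) tx.shift.shift)
              (transition tg.shift.shift tx.shift.shift tw.shift.shift (var 0)))) ↔
          s'.arr 5 ((((i - 1) * n ^ 5 + g) * n + z) * 2 ^ (2 * (S.card + 5)) + w') ≠ 0 ∧
          G.Adj z x ∧ ∀ j < 2 * (S.card + 5), w / 2 ^ j % 2 ≠ 0 → w' / 2 ^ j % 2 ≠ 0 ∨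
            Marks G (markedVertex h.pos S g) (S.card + 5) j x := by
        intro z w' hw'
        have v0' : (var 0).eval s' (scons w' (scons z fun _ => m)) = w' := rfl
        rw [holds_and, holds_and,
          h'.holds_table (i := i - 1) (g := g) (w := w') (x := z) (by omega) hg
            (by rw [eval, eval_shift, eval_shift, ei]; rfl) (by rw [eval_shift, eval_shift, eg])
            rfl rfl,
          h'.holds_adj (x := z) rfl (by rw [eval_shift, eval_shift, ex]),
          h'.holds_transition (x := x) (by rw [eval_shift, eval_shift, eg]; exact hg)
            (by rw [eval_shift, eval_shift, ex]) (by rw [eval_shift, eval_shift, ew]; omega)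
            (by rw [v0']; omega), eval_shift, eval_shift, eval_shift, eval_shift, ew, eg, v0']
      rw [holds_sum, show s'.reg ((0 : Fin 9) + 3) = n from h'.reg3]
      simp only [holds_sum]
      rw [show s'.reg ((4 : Fin 9) + 3) = _ from h'.reg7]
      exact ⟨fun ⟨z, hz, w', hw', h₁⟩ => ⟨⟨z, hz⟩, w', hw', (e ⟨z, hz⟩ w' hw').mp h₁⟩,
        fun ⟨z, w', hw', h₁⟩ => ⟨z, z.isLt, w', hw', (e z w' hw').mpr h₁⟩⟩
    -- For length `0` the transition starts from the empty bit set, so the single vertex must set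
    -- every bit of `w`.
    · have c0 : (const 0).eval s' (fun _ => m) = 0 := rfl
      rw [holds_and, holds_eq, h'.eval_marked (by rw [eg]; omega) (by rw [h5]; omega),
        h'.holds_transition (x := x) (by rwa [eg]) ex (by rw [ew]; omega) (by rw [c0]; omega),
        ex, ew, eg, h5, c0, Fin.ext_iff]
      simp only [Nat.zero_div, Nat.zero_mod, ne_eq, not_true_eq_false, false_or]
  intro i
  induction i with
  | zero =>
    intro hi g hg x w hw
    obtain ⟨s', -, -, e⟩ := key 0 hi g hg x w hw
    rw [e, if_neg (by simp), hasMarkedWalk_zero_iff]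
  | succ i ih =>
    intro hi g hg x w hw
    obtain ⟨s', -, hs', e⟩ := key (i + 1) hi g hg x w hw
    rw [e, if_pos (by simp), hasMarkedWalk_succ_iff]
    refine exists_congr fun z => exists_congr fun w' => and_congr_right fun hw' =>
      and_congr_left fun _ => ?_
    rw [Nat.add_sub_cancel, hs' _ (lt_of_lt_of_le (mul_add_lt
      (d := ((i + 1) * n ^ 5 + g) * n + x) ?_ hw') (Nat.le_add_right _ _)),
      ih (by omega) g hg z w' hw']
    refine lt_of_lt_of_le (mul_add_lt (d := (i + 1) * n ^ 5 + g) ?_ z.isLt) (Nat.le_add_right _ _)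
    have : 0 < n ^ 5 := Nat.pow_pos h.pos
    rw [Nat.add_mul]
    omega

end Ready

end Ram.Term

/-! ### Correctness of the answer -/

namespace Ram.Term

namespace Ready

variable {n : ℕ} {G : SimpleGraph (Fin n)} {S : Finset (Fin n)} {s : State} (h : Ready G S s)

include h

/-- The table only tells whether a distance is at most `t`, so the requirement that `i` not exceed
the distance of the ends is expressed by quantifying over `t`. Register `2` vanishes exactly for a
nonnegative radius. -/
theorem holds_answer_iff (h4 : DistReady G s) (h5 : PathReady h.pos G S s) (hG : G.Connected)
    (v : ℕ → ℕ) : Holds s v answer ↔ s.reg 2 = 0 ∧ ∃ i < n, ∃ g < n ^ 5, ∃ x : Fin n,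
      ∃ w < 2 ^ (2 * (S.card + 5)), HasMarkedWalk G (markedVertex h.pos S g) S.card w i x ∧
        (∀ t < n, G.dist (markedVertex h.pos S g S.card) x ≤ t → i ≤ t) ∧
        (n ≤ i + 1 ∨ ∀ y : Fin n, ∃ j < S.card + 5,
          w / 2 ^ j % 2 ≠ 0 ∧ G.dist y (markedVertex h.pos S g j) ≤ s.reg 1 ∨
          w / 2 ^ (j + (S.card + 5)) % 2 ≠ 0 ∧
            G.dist y (markedVertex h.pos S g j) + 1 ≤ s.reg 1) := by
  have hl := h.le_reg9
  have h3 : ∀ v, (glob 3).eval s v = n := fun _ => h.reg3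
  have h5' : ∀ v, (glob 5).eval s v = S.card := fun _ => h.reg5
  have h10 : ∀ v, (glob 10).eval s v = S.card + 5 := fun _ => h.reg10
  have r0 : s.reg ((0 : Fin 9) + 3) = n := h.reg3
  have r4 : s.reg ((4 : Fin 9) + 3) = 2 ^ (2 * (S.card + 5)) := h.reg7
  have r5 : s.reg ((5 : Fin 9) + 3) = n ^ 5 := h.reg8
  have r7 : s.reg ((7 : Fin 9) + 3) = S.card + 5 := h.reg10
  have fin : ∀ (P : ℕ → Prop) (Q : Fin n → Prop), (∀ y : Fin n, P y ↔ Q y) →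
      ((∀ y < n, P y) ↔ ∀ y : Fin n, Q y) :=
    fun P Q e => ⟨fun h' y => (e y).mp (h' y y.isLt), fun h' y hy => (e ⟨y, hy⟩).mpr (h' _)⟩
  have inner : ∀ i < n, ∀ g < n ^ 5, ∀ x : Fin n, ∀ w < 2 ^ (2 * (S.card + 5)), ∀ y : Fin n,
      ∀ j < S.card + 5,
      Holds s (scons j (scons y (scons w (scons x (scons g (scons i v)))))) (or
        (and (bit (var 2) (var 0)) (within (const 0) (var 1) (marked (var 4) (var 0))))
        (and (bit (var 2) (add (var 0) (glob 10)))
          (within (const 1) (var 1) (marked (var 4) (var 0))))) ↔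
      (w / 2 ^ j % 2 ≠ 0 ∧ G.dist y (markedVertex h.pos S g j) ≤ s.reg 1 ∨
          w / 2 ^ (j + (S.card + 5)) % 2 ≠ 0 ∧
            G.dist y (markedVertex h.pos S g j) + 1 ≤ s.reg 1) := by
    intro i hi g hg x w hw y j hj
    set v' := scons j (scons y (scons w (scons x (scons g (scons i v)))))
    have vj : (var 0).eval s v' = j := rfl
    have vw : (var 2).eval s v' = w := rfl
    have vg : (var 4).eval s v' = g := rfl
    have vjk : (add (var 0) (glob 10)).eval s v' = j + (S.card + 5) := by rw [eval, h10, vj]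
    have hm := h.eval_marked (v := v') (a := var 4) (b := var 0) (by omega) (by omega)
    rw [vg, vj] at hm
    rw [holds_or, holds_and, holds_and, h.holds_within h4 hG (m := 0) (x := y) rfl rfl hm,
      h.holds_within h4 hG (m := 1) (x := y) rfl rfl hm, Holds, Holds,
      h.eval_bit (by omega) (by omega), h.eval_bit (by omega) (by omega), vjk, vj, vw, add_zero]
  have outer : ∀ i < n, ∀ g < n ^ 5, ∀ x : Fin n, ∀ w < 2 ^ (2 * (S.card + 5)),
      Holds s (scons w (scons x (scons g (scons i v)))) (and
        (table (var 3) (var 2) (var 1) (var 0)) (and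
        (all 0 (or (not (distLe (var 0) (marked (var 3) (glob 5)) (var 2))) (le (var 4) (var 0))))
        (or (le (glob 3) (add (var 3) (const 1)))
          (all 0 (sum 7 (or
            (and (bit (var 2) (var 0)) (within (const 0) (var 1) (marked (var 4) (var 0))))
            (and (bit (var 2) (add (var 0) (glob 10)))
              (within (const 1) (var 1) (marked (var 4) (var 0)))))))))) ↔
      HasMarkedWalk G (markedVertex h.pos S g) S.card w i x ∧
        (∀ t < n, G.dist (markedVertex h.pos S g S.card) x ≤ t → i ≤ t) ∧
        (n ≤ i + 1 ∨ ∀ y : Fin n, ∃ j < S.card + 5,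
          w / 2 ^ j % 2 ≠ 0 ∧ G.dist y (markedVertex h.pos S g j) ≤ s.reg 1 ∨
          w / 2 ^ (j + (S.card + 5)) % 2 ≠ 0 ∧
            G.dist y (markedVertex h.pos S g j) + 1 ≤ s.reg 1) := by
    intro i hi g hg x w hw
    rw [holds_and, holds_and, holds_or, holds_all, holds_all, holds_le, h3, r0,
      h.holds_table hi hg (x := x) (w := w) rfl rfl rfl rfl, h5 i hi g hg x w hw]
    refine and_congr_right' (and_congr (forall₂_congr fun t ht => ?_) (or_congr Iff.rfl ?_))
    · have vg : (var 3).eval s (scons t (scons w (scons x (scons g (scons i v))))) = g := rfl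
      have hm := h.eval_marked (v := scons t (scons w (scons x (scons g (scons i v)))))
        (a := var 3) (b := glob 5) (by omega) (by rw [h5']; omega)
      rw [vg, h5'] at hm
      rw [holds_or, holds_not, holds_le, h.holds_distLe h4 (y := x) ht rfl hm rfl,
        ← imp_iff_not_or]
      rfl
    · refine fin _ _ fun y => ?_
      rw [holds_sum, r7]
      exact exists_congr fun j => and_congr_right fun hj => inner i hi g hg x w hw y j hj
  rw [answer, holds_and, holds_le]
  refine and_congr Nat.le_zero ?_
  simp only [holds_sum, r0, r4, r5]
  refine exists_congr fun i => and_congr_right fun hi => exists_congr fun g =>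
    and_congr_right fun hg => ?_
  exact ⟨fun ⟨x, hx, w, hw, h'⟩ => ⟨⟨x, hx⟩, w, hw, (outer i hi g hg ⟨x, hx⟩ w hw).mp h'⟩,
    fun ⟨x, w, hw, h'⟩ => ⟨x, x.isLt, w, hw, (outer i hi g hg x w hw).mpr h'⟩⟩

theorem holds_answer (h4 : DistReady G s) (h5 : PathReady h.pos G S s) (hG : G.Connected)
    (hS : IsSplitVertexDeletionSet G (S : Set (Fin n))) {l : ℤ} (h1 : s.reg 1 = l.toNat)
    (h2 : s.reg 2 = (-l).toNat) (v : ℕ → ℕ) :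
    Holds s v answer ↔ HasEccentricityShortestPath G l := by
  classical
  rw [h.holds_answer_iff h4 h5 hG]
  rcases lt_or_ge l 0 with hl | hl
  · exact iff_of_false (fun h' => by omega) (not_hasEccentricityShortestPath_of_neg hl)
  rw [hasEccentricityShortestPath_iff_witnessed hG hS hl (k := S.card)
    (Γ := {u | ∃ g < n ^ 5, u = markedVertex h.pos S g})
    (by rintro _ ⟨g, -, rfl⟩ x hx; exact exists_markedVertex_eq h.pos g hx)
    (fun f => by
      obtain ⟨g, hg, e⟩ := exists_guess h.pos S f
      exact ⟨_, ⟨g, hg, rfl⟩, e⟩), and_iff_right (by omega), h1]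
  constructor
  · rintro ⟨i, hi, g, hg, x, w, -, ⟨p, rfl, hp⟩, hd, h'⟩
    refine ⟨_, ⟨g, hg, rfl⟩, x, p, ?_, h'.imp_right fun h' y => ?_⟩
    · have := SimpleGraph.dist_le p
      -- Take `t` to be the distance itself, which is below `n` because the walk is.
      exact le_antisymm (hd _ (by omega) le_rfl) this
    · obtain ⟨j, hj, ⟨hb, hy⟩ | ⟨hb, hy⟩⟩ := h' y
      · obtain ⟨z, hz, hm⟩ := hp j (by omega) hb
        rw [Marks, if_pos hj] at hm
        exact ⟨j, hj, .inl ⟨hm ▸ hz, hy⟩⟩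
      · obtain ⟨z, hz, hm⟩ := hp (j + (S.card + 5)) (by omega) hb
        rw [Marks, if_neg (by omega), Nat.add_sub_cancel] at hm
        exact ⟨j, hj, .inr ⟨⟨z, hz, hm⟩, hy⟩⟩
  · rintro ⟨_, ⟨g, hg, rfl⟩, x, p, hp, h'⟩
    -- The bit set `w` records exactly the marks that the path sets.
    obtain ⟨w, hw, hb⟩ := exists_lt_pow_digits (b := 2) (2 * (S.card + 5))
      (fun j => if ∃ x ∈ p.support, Marks G (markedVertex h.pos S g) (S.card + 5) j x
        then 1 else 0) fun j => by split_ifs <;> omega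
    have hlt := (p.isPath_of_length_eq_dist hp).length_lt
    rw [Fintype.card_fin] at hlt
    refine ⟨p.length, hlt, g, hg, x, w, hw, ⟨p, rfl, fun j hj hj' => ?_⟩,
      fun t _ ht => hp ▸ ht, h'.imp_right fun h' y => ?_⟩
    · rw [hb j hj] at hj'
      by_contra hn
      exact hj' (if_neg hn)
    · obtain ⟨j, hj, ⟨hu, hy⟩ | ⟨⟨z, hz, hu⟩, hy⟩⟩ := h' y
      · refine ⟨j, hj, .inl ⟨?_, hy⟩⟩
        rw [hb j (by omega), if_pos ⟨_, hu, by rw [Marks, if_pos hj]⟩]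
        exact one_ne_zero
      · refine ⟨j, hj, .inr ⟨?_, hy⟩⟩
        rw [hb _ (by omega), if_pos ⟨z, hz, by
          rw [Marks, if_neg (by omega), Nat.add_sub_cancel]; exact hu⟩]
        exact one_ne_zero

end Ready

end Ram.Term

namespace Ram.Cmd

open Term

/-! ### The program -/

/-- The powers of the content of register `g + 3`. -/
def powers (a : ℕ) (g : Fin 9) : Term :=
  .ite (var 0) (sum g (read a (sub (var 1) (const 1)))) (const 1)

/-- Each power is a sum of copies of the preceding cell, as many as the base says, so no
multiplication is needed. -/
theorem tabulate_powers (a : ℕ) (g : Fin 9) (s : State) {j m : ℕ} (h : j < m) :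
    (tabulate a (powers a g) s m).arr a j = s.reg (g + 3) ^ j := by
  induction j with
  | zero => rw [tabulate_arr _ _ _ h]; rfl
  | succ j ih =>
    rw [tabulate_arr _ _ _ h, powers, eval_ite,
      if_pos (show Holds _ (fun _ => j + 1) (var 0) from Nat.succ_ne_zero j), eval, tabulate_reg]
    have : ∀ x, (read a (sub (var 1) (const 1))).eval (tabulate a (powers a g) s (j + 1))
        (scons x fun _ => j + 1) = s.reg (g + 3) ^ j := by
      intro x
      rw [← ih (by omega), tabulate_arr_of_lt a _ s (m := m) (m' := j + 1) (by omega) (by omega)]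
      rfl
    rw [← powers]
    simp only [this, Finset.sum_const, Finset.card_range, smul_eq_mul]
    rw [pow_succ']

/-- Set the registers `3, …, 10` and the arrays of powers. -/
def preparation : List Cmd :=
  [set 3 (glob 0), set 4 (const 2), set 5 (sum 0 (read 1 (var 0))),
    set 10 (add (glob 5) (const 5)), set 6 (add (glob 10) (glob 10)),
    fill 2 3 (powers 2 1), fill 3 3 (powers 3 0),
    set 7 (add (read 2 (sub (glob 6) (const 1))) (read 2 (sub (glob 6) (const 1)))),
    set 8 (read 3 (const 5)), set 9 (sum 0 (sum 5 (sum 0 (glob 7))))]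

/-- The program that decides the eccentricity shortest path problem. -/
def program : List Cmd :=
  preparation ++ [fill 4 6 distTable, fill 5 6 pathTable, set 0 (.ite answer (const 1) (const 0))]

/-- The loop bounds of a state are at most `M`. -/
def LoopsLe (M : ℕ) (s : State) : Prop := ∀ x, 3 ≤ x → x < 12 → s.reg x ≤ M

theorem run_set_reg (s : State) (g : Fin 12) (e : Term) (r : ℕ) :
    (run s (set g e)).reg r = if r = g then e.eval s (fun _ => 0) else s.reg r :=
  Function.update_apply _ _ _ _

theorem run_fill_reg (s : State) (a : ℕ) (g : Fin 9) (e : Term) :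
    (run s (fill a g e)).reg = s.reg := tabulate_reg _ _ _ _

theorem LoopsLe.set {M : ℕ} {s : State} (h : LoopsLe M s) {g : Fin 12} {e : Term}
    (he : e.eval s (fun _ => 0) ≤ M) : LoopsLe M (run s (set g e)) := by
  intro x h₁ h₂
  rw [run_set_reg]
  split_ifs
  · exact he
  · exact h x h₁ h₂

theorem LoopsLe.fill {M : ℕ} {s : State} (h : LoopsLe M s) {a : ℕ} {g : Fin 9} {e : Term} :
    LoopsLe M (run s (fill a g e)) := by
  intro x h₁ h₂
  rw [run_fill_reg]
  exact h x h₁ h₂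

theorem preparation_spec {n : ℕ} (hn : 0 < n) (G : SimpleGraph (Fin n)) (S : Finset (Fin n))
    (l : ℤ) {M : ℕ} (hM : M = n * n ^ 5 * n * 2 ^ (2 * (S.card + 5))) :
    ∃ s, preparation.foldl run (espInput G S l) = s ∧ Ready G S s ∧ s.reg 1 = l.toNat ∧
      s.reg 2 = (-l).toNat ∧ LoopsLe M s ∧
      ∀ cs, BoundedBy M s cs → BoundedBy M (espInput G S l) (preparation ++ cs) := by
  obtain ⟨s₀, e₀⟩ : ∃ s, s = espInput G S l := ⟨_, rfl⟩
  obtain ⟨s₁, e₁⟩ : ∃ s, s = run s₀ (set 3 (glob 0)) := ⟨_, rfl⟩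
  obtain ⟨s₂, e₂⟩ : ∃ s, s = run s₁ (set 4 (const 2)) := ⟨_, rfl⟩
  obtain ⟨s₃, e₃⟩ : ∃ s, s = run s₂ (set 5 (sum 0 (read 1 (var 0)))) := ⟨_, rfl⟩
  obtain ⟨s₄, e₄⟩ : ∃ s, s = run s₃ (set 10 (add (glob 5) (const 5))) := ⟨_, rfl⟩
  obtain ⟨s₅, e₅⟩ : ∃ s, s = run s₄ (set 6 (add (glob 10) (glob 10))) := ⟨_, rfl⟩
  obtain ⟨s₆, e₆⟩ : ∃ s, s = run s₅ (fill 2 3 (powers 2 1)) := ⟨_, rfl⟩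
  obtain ⟨s₇, e₇⟩ : ∃ s, s = run s₆ (fill 3 3 (powers 3 0)) := ⟨_, rfl⟩
  obtain ⟨s₈, e₈⟩ : ∃ s, s = run s₇ (set 7 (add (read 2 (sub (glob 6) (const 1)))
    (read 2 (sub (glob 6) (const 1))))) := ⟨_, rfl⟩
  obtain ⟨s₉, e₉⟩ : ∃ s, s = run s₈ (set 8 (read 3 (const 5))) := ⟨_, rfl⟩
  obtain ⟨s, e⟩ : ∃ s, s = run s₉ (set 9 (sum 0 (sum 5 (sum 0 (glob 7))))) := ⟨_, rfl⟩
  have hlist : preparation.foldl run (espInput G S l) = s := by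
    simp only [preparation, List.foldl, ← e₀, ← e₁, ← e₂, ← e₃, ← e₄, ← e₅, ← e₆, ← e₇, ← e₈,
      ← e₉, ← e]
  have z : ∀ x, 3 ≤ x → s₀.reg x = 0 := by
    rintro (_ | _ | _ | x) hx
    · omega
    · omega
    · omega
    · rw [e₀]; rfl
  have a01 : s₁.arr = s₀.arr := by rw [e₁]; rfl
  have a12 : s₂.arr = s₁.arr := by rw [e₂]; rfl
  have a23 : s₃.arr = s₂.arr := by rw [e₃]; rfl
  have a34 : s₄.arr = s₃.arr := by rw [e₄]; rfl
  have a45 : s₅.arr = s₄.arr := by rw [e₅]; rfl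
  have a78 : s₈.arr = s₇.arr := by rw [e₈]; rfl
  have a89 : s₉.arr = s₈.arr := by rw [e₉]; rfl
  have a90 : s.arr = s₉.arr := by rw [e]; rfl
  have arr1 : ∀ x, s₀.arr 1 x = if ∃ i ∈ S, x = (i : ℕ) then 1 else 0 := by
    intro x
    rw [e₀]
    simp only [espInput]
  have v₁ : (glob 0).eval s₀ (fun _ => 0) = n := by rw [e₀]; rfl
  have r₁ : ∀ x, s₁.reg x = if x = 3 then n else s₀.reg x := fun x => by
    rw [e₁, run_set_reg, v₁]; rfl
  have r₂ : ∀ x, s₂.reg x = if x = 4 then 2 else s₁.reg x := fun x => by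
    rw [e₂, run_set_reg]; rfl
  have v₃ : (sum 0 (read 1 (var 0))).eval s₂ (fun _ => 0) = S.card := by
    rw [eval, show s₂.reg ((0 : Fin 9) + 3) = n by
      rw [show ((0 : Fin 9) : ℕ) + 3 = 3 from rfl, r₂, r₁]; rfl, ← sum_indicator S]
    refine Finset.sum_congr rfl fun x _ => ?_
    rw [← arr1, ← a01, ← a12]
    rfl
  have r₃ : ∀ x, s₃.reg x = if x = 5 then S.card else s₂.reg x := fun x => by
    rw [e₃, run_set_reg, v₃]; rfl
  have v₄ : (add (glob 5) (const 5)).eval s₃ (fun _ => 0) = S.card + 5 := by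
    simp [eval, r₃]
  have r₄ : ∀ x, s₄.reg x = if x = 10 then S.card + 5 else s₃.reg x := fun x => by
    rw [e₄, run_set_reg, v₄]; rfl
  have v₅ : (add (glob 10) (glob 10)).eval s₄ (fun _ => 0) = 2 * (S.card + 5) := by
    simp [eval, r₄]
    omega
  have r₅ : ∀ x, s₅.reg x = if x = 6 then 2 * (S.card + 5) else s₄.reg x := fun x => by
    rw [e₅, run_set_reg, v₅]; rfl
  have r₆ : s₆.reg = s₅.reg := by rw [e₆, run_fill_reg]
  have r₇ : s₇.reg = s₆.reg := by rw [e₇, run_fill_reg]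
  have b₆ : s₅.reg ((3 : Fin 9) + 3) = 2 * (S.card + 5) := r₅ 6
  have p₂ : ∀ j < 2 * (S.card + 5), s₇.arr 2 j = 2 ^ j := by
    intro j hj
    rw [e₇, run, tabulate_arr_of_ne _ _ _ _ (by omega), e₆, run,
      tabulate_powers _ _ _ (by rwa [b₆])]
    congr 1
    exact (r₅ 4).trans (by simp [r₄, r₃, r₂])
  have p₃ : ∀ j < 2 * (S.card + 5), s₇.arr 3 j = n ^ j := by
    intro j hj
    rw [e₇, run, tabulate_powers _ _ _ (by rw [r₆]; rwa [b₆]), r₆]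
    congr 1
    exact (r₅ 3).trans (by simp [r₄, r₃, r₂, r₁])
  have a57 : ∀ a < 2, s₇.arr a = s₀.arr a := by
    intro a ha
    rw [e₇, run, tabulate_arr_of_ne _ _ _ _ (by omega), e₆, run,
      tabulate_arr_of_ne _ _ _ _ (by omega), a45, a34, a23, a12, a01]
  -- The arrays hold the powers with exponent below `2 * (k + 5)`. So `n ^ 5` can be read off, but
  -- `2 ^ (2 * (k + 5))` is obtained by doubling the last entry.
  have v₈ : (add (read 2 (sub (glob 6) (const 1))) (read 2 (sub (glob 6) (const 1)))).eval s₇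
      (fun _ => 0) = 2 ^ (2 * (S.card + 5)) := by
    have h6 : (sub (glob 6) (const 1)).eval s₇ (fun _ => 0) = 2 * S.card + 9 := by
      simp [eval, r₇, r₆, r₅]
      omega
    rw [eval, eval, h6, p₂ _ (by omega), show 2 * (S.card + 5) = 2 * S.card + 9 + 1 by ring,
      pow_succ 2 (2 * S.card + 9), mul_two]
  have r₈ : ∀ x, s₈.reg x = if x = 7 then 2 ^ (2 * (S.card + 5)) else s₇.reg x := fun x => by
    rw [e₈, run_set_reg, v₈]; rfl
  have v₉ : (read 3 (const 5)).eval s₈ (fun _ => 0) = n ^ 5 := by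
    rw [eval, a78]
    exact p₃ 5 (by omega)
  have r₉ : ∀ x, s₉.reg x = if x = 8 then n ^ 5 else s₈.reg x := fun x => by
    rw [e₉, run_set_reg, v₉]; rfl
  have v : (sum 0 (sum 5 (sum 0 (glob 7)))).eval s₉ (fun _ => 0) = M := by
    simp only [eval, Finset.sum_const, Finset.card_range, smul_eq_mul]
    rw [show s₉.reg ((0 : Fin 9) + 3) = n from
        (r₉ 3).trans (by simp [r₈, r₇, r₆, r₅, r₄, r₃, r₂, r₁]),
      show s₉.reg ((5 : Fin 9) + 3) = n ^ 5 from r₉ 8,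
      show s₉.reg (7 : Fin 12) = 2 ^ (2 * (S.card + 5)) from
        (r₉ 7).trans (by simp [r₈]), hM]
    ring
  have r : ∀ x, s.reg x = if x = 9 then M else s₉.reg x := fun x => by
    rw [e, run_set_reg, v]; rfl
  have hready : Ready G S s :=
    { pos := hn
      reg3 := by simp [r, r₉, r₈, r₇, r₆, r₅, r₄, r₃, r₂, r₁]
      reg4 := by simp [r, r₉, r₈, r₇, r₆, r₅, r₄, r₃, r₂]
      reg5 := by simp [r, r₉, r₈, r₇, r₆, r₅, r₄, r₃]
      reg6 := by simp [r, r₉, r₈, r₇, r₆, r₅]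
      reg7 := by simp [r, r₉, r₈]
      reg8 := by simp [r, r₉]
      reg9 := by simp [r, hM]
      reg10 := by simp [r, r₉, r₈, r₇, r₆, r₅, r₄]
      arr0 := by
        intro x y
        rw [a90, a89, a78, a57 0 (by omega), e₀]
        simp only [espInput]
        split_ifs with h
        · obtain ⟨i, j, hij, ha⟩ := h
          -- Quotient and remainder by `n` recover row and column, so the cell belongs to one pair
          -- of vertices only.
          have h₁ := mul_add_div_mod (a := x) y.isLt
          have h₂ := mul_add_div_mod (a := i) j.isLt
          rw [hij] at h₁
          obtain rfl : i = x := Fin.ext (h₂.1.symm.trans h₁.1)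
          obtain rfl : j = y := Fin.ext (h₂.2.symm.trans h₁.2)
          exact iff_of_true one_ne_zero ha
        · exact iff_of_false (by simp) fun ha => h ⟨x, y, rfl, ha⟩
      arr1 := by
        intro x
        rw [a90, a89, a78, a57 1 (by omega), arr1]
      arr2 := by rw [a90, a89, a78]; exact p₂
      arr3 := by rw [a90, a89, a78]; exact p₃ }
  have hl := hready.le_reg9
  rw [hready.reg9, ← hM] at hl
  -- This bounds the registers `4`, `5`, `6` and `10`, whose contents are not factors of `M`.
  have hlog : 2 * (S.card + 5) < 2 ^ (2 * (S.card + 5)) := Nat.lt_two_pow_self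
  have l₀ : LoopsLe M s₀ := fun x h₁ _ => by rw [z x h₁]; exact Nat.zero_le _
  have l₁ : LoopsLe M s₁ := e₁ ▸ l₀.set (by rw [v₁]; omega)
  have l₂ : LoopsLe M s₂ := e₂ ▸ l₁.set (show 2 ≤ M by omega)
  have l₃ : LoopsLe M s₃ := e₃ ▸ l₂.set (by rw [v₃]; omega)
  have l₄ : LoopsLe M s₄ := e₄ ▸ l₃.set (by rw [v₄]; omega)
  have l₅ : LoopsLe M s₅ := e₅ ▸ l₄.set (by rw [v₅]; omega)
  have l₆ : LoopsLe M s₆ := e₆ ▸ l₅.fill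
  have l₇ : LoopsLe M s₇ := e₇ ▸ l₆.fill
  have l₈ : LoopsLe M s₈ := e₈ ▸ l₇.set (by rw [v₈]; omega)
  have l₉ : LoopsLe M s₉ := e₉ ▸ l₈.set (by rw [v₉]; omega)
  have ls : LoopsLe M s := e ▸ l₉.set (by rw [v])
  refine ⟨s, hlist, hready, ?_, ?_, ls, fun cs hcs => ?_⟩
  · simp only [r, r₉, r₈, r₇, r₆, r₅, r₄, r₃, r₂, r₁, e₀]
    rfl
  · simp only [r, r₉, r₈, r₇, r₆, r₅, r₄, r₃, r₂, r₁, e₀]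
    rfl
  · simp only [preparation, List.cons_append, List.nil_append, BoundedBy, ← e₀, ← e₁, ← e₂, ← e₃,
      ← e₄, ← e₅, ← e₆, ← e₇, ← e₈, ← e₉, ← e]
    exact ⟨l₀, l₁, l₂, l₃, l₄, l₅, l₆, l₇, l₈, l₉, hcs⟩

theorem program_spec {n : ℕ} {G : SimpleGraph (Fin n)} {S : Finset (Fin n)} (l : ℤ)
    (hG : G.Connected) (hS : IsSplitVertexDeletionSet G (S : Set (Fin n))) {M : ℕ}
    (hM : M = n * n ^ 5 * n * 2 ^ (2 * (S.card + 5))) [Decidable (HasEccentricityShortestPath G l)] :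
    BoundedBy M (espInput G S l) program ∧ (program.foldl run (espInput G S l)).reg 0 =
      if HasEccentricityShortestPath G l then 1 else 0 := by
  have hn : 0 < n := Fin.pos_iff_nonempty.mpr hG.nonempty
  obtain ⟨s, e, h, h1, h2, hs, hb⟩ := preparation_spec hn G S l hM
  refine ⟨hb _ ⟨hs, hs.fill, hs.fill.fill, trivial⟩, ?_⟩
  rw [program, List.foldl_append, e]
  have hr : Ready G S (tabulate 4 distTable s (s.reg 9)) := h.tabulate (by omega) _ _
  have hr' := hr.tabulate (a := 5) (by omega) pathTable
    ((tabulate 4 distTable s (s.reg 9)).reg 9)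
  have h5 := hr.pathReady
  have h4 : DistReady G (tabulate 5 pathTable (tabulate 4 distTable s (s.reg 9))
      ((tabulate 4 distTable s (s.reg 9)).reg 9)) := by
    intro t ht x y
    rw [tabulate_arr_of_ne _ _ _ _ (by omega)]
    exact h.distReady hG t ht x y
  have key := hr'.holds_answer h4 h5 hG hS (l := l)
    (by rw [tabulate_reg, tabulate_reg, h1]) (by rw [tabulate_reg, tabulate_reg, h2]) (fun _ => 0)
  change (run (tabulate 5 pathTable (tabulate 4 distTable s (s.reg 9))
      ((tabulate 4 distTable s (s.reg 9)).reg 9)) (set 0 (.ite answer (const 1) (const 0)))).reg 0 = _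
  rw [run_set_reg, if_pos (show 0 = ((0 : Fin 12) : ℕ) from rfl), eval_ite]
  simp only [key]
  rfl

/-- The exponent satisfies `2 * (k + 5) ≤ 12 + 2 * k * log k`: for `k ≥ 2` the logarithm is at least
1, and for `k ≤ 1` the product `k * log k` is `0`. The case `k = 1` requires the constant `12`,
which goes into the leading factor. -/
theorem bound_le (C d n k : ℕ) : ((C * (n * n ^ 5 * n * 2 ^ (2 * (k + 5))) ^ d : ℕ) : ℝ) ≤
    ((C * 2 ^ (12 * d) : ℕ) : ℝ) *
      (2 : ℝ) ^ (((2 * d : ℕ) : ℝ) * ((k : ℝ) * Real.logb 2 (k : ℝ))) * (n : ℝ) ^ (7 * d) := by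
  have hk : (2 * (k + 5) : ℝ) ≤ 12 + 2 * ((k : ℝ) * Real.logb 2 k) := by
    rcases Nat.lt_or_ge k 2 with h | h
    · interval_cases k <;> norm_num
    · have h' : (2 : ℝ) ≤ k := by exact_mod_cast h
      have : 1 ≤ Real.logb 2 (k : ℝ) := by
        rw [Real.le_logb_iff_rpow_le (by norm_num) (by linarith)]
        simpa using h'
      nlinarith
  have hexp : (2 : ℝ) ^ (2 * (k + 5) * d) ≤
      2 ^ (12 * d) * (2 : ℝ) ^ (((2 * d : ℕ) : ℝ) * ((k : ℝ) * Real.logb 2 (k : ℝ))) := by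
    rw [← Real.rpow_natCast, ← Real.rpow_natCast, ← Real.rpow_add (by norm_num)]
    refine Real.rpow_le_rpow_of_exponent_le (by norm_num) ?_
    push_cast
    have := mul_le_mul_of_nonneg_right hk (Nat.cast_nonneg (α := ℝ) d)
    linarith
  have e : (n * n ^ 5 * n * 2 ^ (2 * (k + 5))) ^ d = n ^ (7 * d) * 2 ^ (2 * (k + 5) * d) := by
    rw [mul_pow, ← pow_mul, pow_mul n 7 d]
    ring
  rw [e]
  push_cast
  calc (C : ℝ) * (n ^ (7 * d) * 2 ^ (2 * (k + 5) * d))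
      ≤ C * (n ^ (7 * d) *
        (2 ^ (12 * d) * (2 : ℝ) ^ (((2 * d : ℕ) : ℝ) * ((k : ℝ) * Real.logb 2 (k : ℝ))))) := by
        gcongr
    _ = _ := by push_cast; ring

end Ram.Cmd

/-- A single program decides, for every connected graph `G` on `n` vertices, every split vertex
deletion set `S` of `G` and every integer `l`, the eccentricity shortest path problem, by a final
value `1` (yes) or `0` (no) of register `0`, in `O(2 ^ O(k log k) * n ^ O(1))` steps, `k = |S|`. -/
theorem theorem4 :
    ∃ (p : Ram.Prog) (a b c : ℕ),
      ∀ (n : ℕ) (G : SimpleGraph (Fin n)) (S : Finset (Fin n)) (l : ℤ),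
        G.Connected → IsSplitVertexDeletionSet G (S : Set (Fin n)) →
        ∃ (s : Ram.State) (t : ℕ), Ram.Exec p (espInput G S l) s t ∧
          (HasEccentricityShortestPath G l → s.reg 0 = 1) ∧
          (¬ HasEccentricityShortestPath G l → s.reg 0 = 0) ∧
          (t : ℝ) ≤ (a : ℝ) * (2 : ℝ) ^ ((b : ℝ) * ((S.card : ℝ) * Real.logb 2 (S.card : ℝ))) *
            (n : ℝ) ^ c := by
  classical
  obtain ⟨C, d, h⟩ := Ram.Cmd.exec_compList Ram.Cmd.program
  refine ⟨Ram.Cmd.compList Ram.Cmd.program, C * 2 ^ (12 * d), 2 * d, 7 * d,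
    fun n G S l hG hS => ?_⟩
  have hn : 0 < n := Fin.pos_iff_nonempty.mpr hG.nonempty
  obtain ⟨hb, hv⟩ := Ram.Cmd.program_spec l hG hS rfl
  obtain ⟨s, t, x, ht, ha⟩ := h (espInput G S l) (espInput G S l) _ (Nat.succ_le_of_lt
    (by positivity)) ⟨fun _ _ => rfl, rfl⟩ hb
  refine ⟨s, t, x, fun hE => ?_, fun hE => ?_, ?_⟩
  · rw [ha.1 0 (by omega), hv, if_pos hE]
  · rw [ha.1 0 (by omega), hv, if_neg hE]
  · exact (Nat.cast_le.mpr ht).trans (Ram.Cmd.bound_le C d n S.card)
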